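/- For every real $p>3$ there is a constant $c_p>0$, depending only on $p$, with the following property. Let $\delta\in(0,1]$. By a curve of length $1$ we mean an arc $\gamma\subset\mathbb{R}^2$ (the image of $[0,1]$ under an injective continuous map into $\mathbb{R}^2$) with $\mathcal{H}^1(\gamma)=1$, where $\mathcal{H}^1$ denotes one-dimensional Hausdorff measure. Suppose that to every such curve $\gamma$ there are associated an $\mathcal{H}^1$-measurable subset $E_\gamma\subset\gamma$ with $\mathcal{H}^1(E_\gamma)\ge\delta$ and an isometry $\iota_\gamma$ of $\mathbb{R}^2$. Then the union $\bigcup_\gamma \iota_\gamma(E_\gamma)$, taken over all curves $\gamma$ of length $1$, has Lebesgue outer measure at least $c_p\,\delta^p$. -/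

import Mathlib

open MeasureTheory
open scoped MeasureTheory

/-- The Euclidean plane. -/
abbrev Plane : Type := EuclideanSpace ℝ (Fin 2)

/-- A (rectifiable) plane curve of length one, regarded as a point set: an arc, i.e. the image of
`[0, 1]` under an injective continuous map, of one-dimensional Hausdorff measure `1`.
For an arc, `μH[1]` of the point set is the length of the curve, so that rectifiability is
automatic. Curves that retrace themselves are not included (their length is not the `μH[1]`-measure
of the point set, which may be too small to have any subset of length `δ`). -/
def IsUnitLengthCurve (γ : Set Plane) : Prop :=
  (∃ φ : ℝ → Plane, ContinuousOn φ (Set.Icc 0 1) ∧ Set.InjOn φ (Set.Icc 0 1) ∧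
    φ '' Set.Icc 0 1 = γ) ∧
  μH[1] γ = 1

/-- Measurability with respect to the outer measure `ℋ¹` on the plane (Carathéodory). -/
def IsH1Measurable (E : Set Plane) : Prop :=
  (μH[1] : Measure Plane).toOuterMeasure.IsCaratheodory E

/-! If the union has small outer measure, it lies in an open set `V` of small measure. It then
suffices to build, from `V` alone, one curve such that under every isometry only a small proportion
of it falls into `V`. Whatever isometry is prescribed for this curve, a subset of measure `δ` cannot
be carried into `V`.

The curve is a limit of perturbations of a segment of length `2`, controlled by the mean density of
the set along all congruent copies. `V` is first replaced by its periodization, so that isometries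
matter only modulo integer translations and have a net of polynomial size (`exists_isometry_net`).
For the segment, the mean density at scale `R` is at most `M / R`, where `M` is comparable to the
measure of `V` (`integral_density_segment_le`).

To pass from scale `R` to a much smaller `r`, cut the parameter interval into `N` pieces and
translate each by a vector of length about `R`. Averaged over such a vector, the density at scale
`r` is essentially bounded by that at scale `R` (`setAverage_density_le`). A derandomized Chernoff
bound (`exists_sum_exp_le`) picks translations good for the whole net at once, with additive error
`d`, once `N` exceeds about `log (1 / r) / d`. Cutting off the translations near the ends of the
pieces gives Lipschitz constant about `R * N / d`, so the construction needs `R * log (1 / R)` to be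
at most about `d ^ 2`.

The errors are summable over the scales, and Fatou's lemma bounds the time spent in `V` by a
multiple of `M / R + d` (`exists_perturbed_segment`). Taking `d` and `M / R` comparable to `δ`
requires `R` slightly below `δ ^ 2`, hence `M` slightly below `δ ^ 3`: this is why `p > 3`. -/

open Metric Filter Topology

/-! ### Density at a given scale and its averages -/

/-- The proportion of the disc of radius `R` about `y` which is covered by `U`. -/
noncomputable def density (U : Set Plane) (R : ℝ) (y : Plane) : ℝ :=
  volume.real (U ∩ ball y R) / (Real.pi * R ^ 2)

theorem volume_ball_plane (y : Plane) {R : ℝ} (hR : 0 ≤ R) :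
    volume (ball y R) = ENNReal.ofReal (Real.pi * R ^ 2) := by
  rw [EuclideanSpace.volume_ball_fin_two, mul_comm, ENNReal.ofReal_mul Real.pi_pos.le,
    ENNReal.ofReal_pow hR, ENNReal.ofReal_eq_coe_nnreal Real.pi_pos.le]

theorem volume_inter_ball_ne_top (U : Set Plane) (y : Plane) (R : ℝ) :
    volume (U ∩ ball y R) ≠ ⊤ :=
  ((measure_mono Set.inter_subset_right).trans_lt measure_ball_lt_top).ne

theorem density_nonneg (U : Set Plane) (R : ℝ) (y : Plane) : 0 ≤ density U R y := by
  unfold density; positivity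

theorem density_le_one (U : Set Plane) {R : ℝ} (hR : 0 < R) (y : Plane) : density U R y ≤ 1 := by
  unfold density
  have hp := Real.pi_pos
  rw [div_le_one (by positivity)]
  have h : volume.real (ball y R) = Real.pi * R ^ 2 := by
    rw [Measure.real, volume_ball_plane y hR.le, ENNReal.toReal_ofReal (by positivity)]
  rw [← h]
  exact measureReal_mono Set.inter_subset_right measure_ball_lt_top.ne

theorem measurableSet_incidence {T : Type*} [MeasurableSpace T] {U : Set Plane}
    (hU : MeasurableSet U) (R : ℝ) {c : T → Plane} (hc : Measurable c) :
    MeasurableSet {q : T × Plane | q.2 ∈ U ∩ ball (c q.1) R} :=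
  (measurable_snd hU).inter
    (measurableSet_lt (measurable_snd.dist (hc.comp measurable_fst)) measurable_const)

theorem measurable_density {U : Set Plane} (hU : MeasurableSet U) (R : ℝ) :
    Measurable (density U R) :=
  ((measurable_measure_prodMk_left (ν := (volume : Measure Plane))
    (measurableSet_incidence hU R measurable_id)).ennreal_toReal).div_const _

/-- Tonelli on the incidence set. Averages of densities are thereby reduced to the measure of the
parameters whose centre is within `R` of a fixed point `w`. -/
theorem lintegral_volume_inter_ball {T : Type*} [MeasurableSpace T] (μ : Measure T) [SFinite μ]
    {U : Set Plane} (hU : MeasurableSet U) (R : ℝ) {c : T → Plane} (hc : Measurable c) :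
    ∫⁻ t, volume (U ∩ ball (c t) R) ∂μ = ∫⁻ w in U, μ {t | w ∈ ball (c t) R} := by
  have hS := measurableSet_incidence hU R hc
  have h1 := Measure.prod_apply (μ := μ) (ν := (volume : Measure Plane)) hS
  rw [Measure.prod_apply_symm hS] at h1
  have h2 : ∫⁻ t, volume (U ∩ ball (c t) R) ∂μ =
      ∫⁻ t, volume (Prod.mk t ⁻¹' {q : T × Plane | q.2 ∈ U ∩ ball (c q.1) R}) ∂μ := rfl
  rw [h2, ← h1, ← lintegral_indicator hU]
  refine lintegral_congr fun w => ?_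
  by_cases hw : w ∈ U
  · simp [hw, Set.preimage]
  · simp [hw, Set.preimage]

theorem density_le_of_ball_subset {U : Set Plane} {R R' : ℝ} (hR : 0 < R) {y y' : Plane}
    (h : dist y y' + R ≤ R') : density U R y ≤ (R' / R) ^ 2 * density U R' y' := by
  have hR' : 0 < R' := by linarith [dist_nonneg (x := y) (y := y')]
  have hp := Real.pi_pos
  have h1 : volume.real (U ∩ ball y R) ≤ volume.real (U ∩ ball y' R') :=
    measureReal_mono (Set.inter_subset_inter_right _ (ball_subset_ball' (by linarith)))
      (volume_inter_ball_ne_top U y' R')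
  unfold density
  have h2 : (R' / R) ^ 2 * (volume.real (U ∩ ball y' R') / (Real.pi * R' ^ 2)) =
      volume.real (U ∩ ball y' R') / (Real.pi * R ^ 2) := by
    field_simp
  rw [h2]
  gcongr

theorem density_eq_one_of_ball_subset {U : Set Plane} {R : ℝ} (hR : 0 < R) {y : Plane}
    (h : ball y R ⊆ U) : density U R y = 1 := by
  have hp := Real.pi_pos
  unfold density
  rw [Set.inter_eq_self_of_subset_right h, Measure.real, volume_ball_plane y hR.le,
    ENNReal.toReal_ofReal (by positivity), div_self (by positivity)]

theorem integral_density {T : Type*} [MeasurableSpace T] (μ : Measure T)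
    {U : Set Plane} (hU : MeasurableSet U) (R : ℝ) {c : T → Plane} (hc : Measurable c) :
    ∫ t, density U R (c t) ∂μ =
      (∫⁻ t, volume (U ∩ ball (c t) R) ∂μ).toReal / (Real.pi * R ^ 2) := by
  unfold density
  rw [integral_div]
  congr 1
  refine integral_toReal ?_ (Filter.Eventually.of_forall fun t =>
    (volume_inter_ball_ne_top U _ R).lt_top)
  exact (measurable_measure_prodMk_left (ν := (volume : Measure Plane))
    (measurableSet_incidence hU R hc)).aemeasurable

/-- A fixed `w` is within `r` of `ι (x + ω)` for a set of `ω` of area at most `π r²`, and for none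
unless `w` is within `ρ + r ≤ R` of `ι x`. For `ρ` close to `R` the loss is close to `1`. -/
theorem setAverage_density_le {U : Set Plane} (hU : MeasurableSet U) {R ρ r : ℝ} (hρ : 0 < ρ)
    (hr : 0 < r) (h : ρ + r ≤ R) (ι : Plane ≃ᵢ Plane) (x : Plane) :
    ⨍ ω in ball (0 : Plane) ρ, density U r (ι (x + ω)) ≤ (R / ρ) ^ 2 * density U R (ι x) := by
  have hp := Real.pi_pos
  have hR : 0 < R := by linarith
  have hc : Measurable fun ω : Plane => ι (x + ω) := by
    have := ι.continuous; fun_prop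
  have key : ∫⁻ ω in ball (0 : Plane) ρ, volume (U ∩ ball (ι (x + ω)) r) ≤
      ENNReal.ofReal (Real.pi * r ^ 2) * volume (U ∩ ball (ι x) R) := by
    rw [lintegral_volume_inter_ball _ hU r hc]
    calc ∫⁻ w in U, (volume.restrict (ball (0 : Plane) ρ)) {ω | w ∈ ball (ι (x + ω)) r}
        ≤ ∫⁻ w in U, (ball (ι x) R).indicator (fun _ => ENNReal.ofReal (Real.pi * r ^ 2)) w := by
          refine lintegral_mono fun w => ?_
          by_cases hw : w ∈ ball (ι x) R
          · rw [Set.indicator_of_mem hw]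
            refine (Measure.restrict_apply_le _ _).trans ?_
            rw [← volume_ball_plane (ι.symm w - x) hr.le]
            refine measure_mono fun ω hω => ?_
            have hω' : dist w (ι (x + ω)) < r := hω
            rw [← ι.symm.dist_eq, ι.symm_apply_apply] at hω'
            rw [mem_ball, dist_comm, dist_eq_norm]
            rw [dist_eq_norm] at hω'
            rwa [sub_sub]
          · rw [Set.indicator_of_notMem hw, nonpos_iff_eq_zero]
            rw [Measure.restrict_apply' measurableSet_ball]
            convert measure_empty (μ := (volume : Measure Plane))
            rw [Set.eq_empty_iff_forall_notMem]
            rintro ω ⟨h1, h2⟩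
            apply hw
            have h1' : dist w (ι (x + ω)) < r := h1
            have h3 : dist (ι (x + ω)) (ι x) < ρ := by
              rw [ι.dist_eq, dist_eq_norm]; simpa using h2
            rw [mem_ball]
            linarith [dist_triangle w (ι (x + ω)) (ι x)]
      _ = ENNReal.ofReal (Real.pi * r ^ 2) * volume (U ∩ ball (ι x) R) := by
          rw [lintegral_indicator_const measurableSet_ball,
            Measure.restrict_apply measurableSet_ball, Set.inter_comm]
  rw [setAverage_eq, integral_density _ hU r hc, smul_eq_mul, Measure.real,
    volume_ball_plane 0 hρ.le, ENNReal.toReal_ofReal (by positivity)]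
  have h1 := ENNReal.toReal_mono (ENNReal.mul_ne_top ENNReal.ofReal_ne_top
    (volume_inter_ball_ne_top U (ι x) R)) key
  rw [ENNReal.toReal_mul, ENNReal.toReal_ofReal (by positivity)] at h1
  calc (Real.pi * ρ ^ 2)⁻¹ * ((∫⁻ ω in ball (0 : Plane) ρ,
        volume (U ∩ ball (ι (x + ω)) r)).toReal / (Real.pi * r ^ 2))
      ≤ (Real.pi * ρ ^ 2)⁻¹ * ((Real.pi * r ^ 2 * (volume (U ∩ ball (ι x) R)).toReal) /
          (Real.pi * r ^ 2)) := by gcongr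
    _ = (R / ρ) ^ 2 * density U R (ι x) := by
        unfold density Measure.real
        field_simp

/-- The segment is traversed at speed `2`, so it stays within `R` of a given point for parameters in
a set of diameter at most `R`. Only points within distance `3` of its initial point are ever met. -/
theorem integral_density_segment_le {U : Set Plane} (hU : MeasurableSet U) {R : ℝ} (hR : 0 < R)
    (hR1 : R ≤ 1) {M : ℝ} (hM0 : 0 ≤ M)
    (hM : ∀ a : Plane, volume (U ∩ ball a 3) ≤ ENNReal.ofReal M)
    (ι : Plane ≃ᵢ Plane) {e : Plane} (he : ‖e‖ = 1) :
    ∫ t in (0 : ℝ)..1, density U R (ι ((2 * t) • e)) ≤ M / R := by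
  have hp := Real.pi_pos
  have hc : Measurable fun t : ℝ => ι ((2 * t) • e) := by
    have := ι.continuous; fun_prop
  have hd : ∀ s t : ℝ, dist (ι ((2 * s) • e)) (ι ((2 * t) • e)) = 2 * |s - t| := fun s t => by
    rw [ι.dist_eq, dist_eq_norm, ← sub_smul, norm_smul, he, ← mul_sub]
    simp
  have key : ∫⁻ t in Set.Ioc (0 : ℝ) 1, volume (U ∩ ball (ι ((2 * t) • e)) R) ≤
      ENNReal.ofReal R * ENNReal.ofReal M := by
    rw [lintegral_volume_inter_ball _ hU R hc]
    calc ∫⁻ w in U, (volume.restrict (Set.Ioc (0 : ℝ) 1)) {t | w ∈ ball (ι ((2 * t) • e)) R}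
        ≤ ∫⁻ w in U, (ball (ι ((2 * (0 : ℝ)) • e)) 3).indicator (fun _ => ENNReal.ofReal R) w := by
          refine lintegral_mono fun w => ?_
          rw [Measure.restrict_apply' measurableSet_Ioc]
          by_cases hw : w ∈ ball (ι ((2 * (0 : ℝ)) • e)) 3
          · rw [Set.indicator_of_mem hw]
            refine (measure_mono Set.inter_subset_left).trans ((Real.volume_le_diam _).trans ?_)
            refine ediam_le fun s hs t ht => ?_
            rw [edist_dist]
            refine ENNReal.ofReal_le_ofReal ?_
            have hs' : dist w (ι ((2 * s) • e)) < R := hs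
            have ht' : dist w (ι ((2 * t) • e)) < R := ht
            have := dist_triangle_left (ι ((2 * s) • e)) (ι ((2 * t) • e)) w
            rw [hd] at this
            rw [Real.dist_eq]
            linarith
          · rw [Set.indicator_of_notMem hw, nonpos_iff_eq_zero]
            convert measure_empty (μ := (volume : Measure ℝ))
            rw [Set.eq_empty_iff_forall_notMem]
            rintro t ⟨h1, h2, h3⟩
            apply hw
            have h1' : dist w (ι ((2 * t) • e)) < R := h1
            have := hd t 0
            rw [sub_zero, abs_of_pos h2] at this
            rw [mem_ball]
            linarith [dist_triangle w (ι ((2 * t) • e)) (ι ((2 * (0 : ℝ)) • e))]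
      _ = ENNReal.ofReal R * volume (U ∩ ball (ι ((2 * (0 : ℝ)) • e)) 3) := by
          rw [lintegral_indicator_const measurableSet_ball,
            Measure.restrict_apply measurableSet_ball, Set.inter_comm]
      _ ≤ _ := by gcongr; exact hM _
  rw [intervalIntegral.integral_of_le zero_le_one, integral_density _ hU R hc]
  rw [← ENNReal.ofReal_mul hR.le] at key
  have h1 := ENNReal.toReal_mono ENNReal.ofReal_ne_top key
  rw [ENNReal.toReal_ofReal (by positivity)] at h1
  calc _ ≤ R * M / (Real.pi * R ^ 2) := by gcongr
    _ = (M / R) * (1 / Real.pi) := by field_simp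
    _ ≤ (M / R) * 1 := by
        gcongr
        rw [div_le_one hp]; linarith [Real.pi_gt_three]
    _ = M / R := mul_one _

/-! ### Simultaneous selection by an exponential potential -/

/-- Selecting the points one at a time, so that an exponential potential does not increase, makes
finitely many sums of bounded functions simultaneously almost as small as sums of their means. -/
theorem exists_sum_exp_le {κ Ω : Type*} [MeasurableSpace Ω] {μ : Measure Ω} {B : Set Ω}
    (hB : μ B ≠ 0) (hB' : μ B ≠ ⊤) (S : Finset κ) {X : ℕ → κ → Ω → ℝ} {m : ℕ → κ → ℝ} {s : ℝ}
    (hs : 0 ≤ s) (hs1 : s ≤ 1) (hX0 : ∀ i k ω, 0 ≤ X i k ω) (hX1 : ∀ i k ω, X i k ω ≤ 1)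
    (hXi : ∀ i k, IntegrableOn (X i k) B μ) (hm : ∀ i k, ⨍ ω in B, X i k ω ∂μ ≤ m i k) (N : ℕ) :
    ∃ ω : ℕ → Ω, (∀ i, ω i ∈ B) ∧
      ∑ k ∈ S, Real.exp (s * ∑ i ∈ Finset.range N, (X i k (ω i) - (1 + s) * m i k)) ≤ S.card := by
  induction N with
  | zero =>
    obtain ⟨b, hb⟩ := nonempty_of_measure_ne_zero hB
    exact ⟨fun _ => b, fun _ => hb, by simp⟩
  | succ N ih =>
    obtain ⟨ω, hω, hsum⟩ := ih
    set w : κ → ℝ := fun k =>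
      Real.exp (s * ∑ i ∈ Finset.range N, (X i k (ω i) - (1 + s) * m i k)) with hw
    -- The weight of `k` with the deterministic factor of the new term absorbed. The next point is
    -- chosen so that the `c`-weighted sum of the `X N k` is at most its average.
    set c : κ → ℝ := fun k => w k * Real.exp (-(s * (1 + s) * m N k)) with hc
    have hc0 : ∀ k, 0 ≤ c k := fun k => by positivity
    obtain ⟨x, hxB, hx⟩ := exists_le_setAverage (f := fun ω => ∑ k ∈ S, c k * X N k ω) hB hB'
      (integrable_finsetSum _ fun k _ => (hXi N k).const_mul (c k))
    have havg : ⨍ ω in B, ∑ k ∈ S, c k * X N k ω ∂μ ≤ ∑ k ∈ S, c k * m N k := by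
      rw [setAverage_eq, integral_finsetSum _ fun k _ => (hXi N k).const_mul (c k),
        Finset.smul_sum]
      refine Finset.sum_le_sum fun k _ => ?_
      rw [integral_const_mul, smul_eq_mul, mul_left_comm]
      have := hm N k
      rw [setAverage_eq, smul_eq_mul] at this
      exact mul_le_mul_of_nonneg_left this (hc0 k)
    refine ⟨Function.update ω N x, fun i => ?_, ?_⟩
    · by_cases hi : i = N
      · subst hi; simpa using hxB
      · simpa [hi] using hω i
    have hterm : ∀ k, Real.exp (s * ∑ i ∈ Finset.range (N + 1),
        (X i k (Function.update ω N x i) - (1 + s) * m i k)) ≤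
        c k + s * (1 + s) * (c k * X N k x) := fun k => by
      have h1 : ∑ i ∈ Finset.range N, (X i k (Function.update ω N x i) - (1 + s) * m i k) =
          ∑ i ∈ Finset.range N, (X i k (ω i) - (1 + s) * m i k) :=
        Finset.sum_congr rfl fun i hi => by
          rw [Function.update_of_ne (Finset.mem_range.1 hi).ne]
      rw [Finset.sum_range_succ, h1, Function.update_self]
      have h2 : s * (∑ i ∈ Finset.range N, (X i k (ω i) - (1 + s) * m i k) +
          (X N k x - (1 + s) * m N k)) =
          s * ∑ i ∈ Finset.range N, (X i k (ω i) - (1 + s) * m i k) + -(s * (1 + s) * m N k) +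
            s * X N k x := by ring
      rw [h2, Real.exp_add, Real.exp_add]
      have hx0 := hX0 N k x
      have hx1 := hX1 N k x
      have hsx : 0 ≤ s * X N k x := by positivity
      -- From `exp y ≤ 1 + y + y²` for `0 ≤ y ≤ 1` and `X² ≤ X`. The quadratic term is what the
      -- factor `1 + s` in front of the means pays for.
      have h3 : Real.exp (s * X N k x) ≤ 1 + s * (1 + s) * X N k x := by
        have h4 := (abs_le.1 (Real.abs_exp_sub_one_sub_id_le (x := s * X N k x)
          (by rw [abs_of_nonneg hsx]; nlinarith))).2
        have h5 : (s * X N k x) ^ 2 ≤ s ^ 2 * X N k x := by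
          rw [mul_pow]
          gcongr
          nlinarith
        nlinarith
      calc c k * Real.exp (s * X N k x) ≤ c k * (1 + s * (1 + s) * X N k x) :=
            mul_le_mul_of_nonneg_left h3 (hc0 k)
        _ = _ := by ring
    calc _ ≤ ∑ k ∈ S, (c k + s * (1 + s) * (c k * X N k x)) :=
          Finset.sum_le_sum fun k _ => hterm k
      _ = ∑ k ∈ S, c k + s * (1 + s) * ∑ k ∈ S, c k * X N k x := by
          rw [Finset.sum_add_distrib, Finset.mul_sum]
      _ ≤ ∑ k ∈ S, c k + s * (1 + s) * ∑ k ∈ S, c k * m N k := by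
          exact add_le_add_right (mul_le_mul_of_nonneg_left (hx.trans havg) (by positivity)) _
      _ = ∑ k ∈ S, c k * (s * (1 + s) * m N k + 1) := by
          rw [Finset.mul_sum, ← Finset.sum_add_distrib]
          exact Finset.sum_congr rfl fun k _ => by ring
      _ ≤ ∑ k ∈ S, w k := by
          refine Finset.sum_le_sum fun k _ => ?_
          calc c k * (s * (1 + s) * m N k + 1) ≤ c k * Real.exp (s * (1 + s) * m N k) :=
                mul_le_mul_of_nonneg_left (Real.add_one_le_exp _) (hc0 k)
            _ = w k := by rw [hc, mul_assoc, ← Real.exp_add]; simp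
      _ ≤ S.card := hsum

/-- Each term of the potential is at most the whole sum; taking logarithms turns the union over `S`
into the additive cost `log S.card / s`. -/
theorem exists_forall_sum_le {κ Ω : Type*} [MeasurableSpace Ω] {μ : Measure Ω} {B : Set Ω}
    (hB : μ B ≠ 0) (hB' : μ B ≠ ⊤) (S : Finset κ) {X : ℕ → κ → Ω → ℝ} {m : ℕ → κ → ℝ} {s : ℝ}
    (hs : 0 < s) (hs1 : s ≤ 1) (hX0 : ∀ i k ω, 0 ≤ X i k ω) (hX1 : ∀ i k ω, X i k ω ≤ 1)
    (hXi : ∀ i k, IntegrableOn (X i k) B μ) (hm : ∀ i k, ⨍ ω in B, X i k ω ∂μ ≤ m i k) (N : ℕ) :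
    ∃ ω : ℕ → Ω, (∀ i, ω i ∈ B) ∧ ∀ k ∈ S, ∑ i ∈ Finset.range N, X i k (ω i) ≤
      (1 + s) * ∑ i ∈ Finset.range N, m i k + Real.log S.card / s := by
  obtain ⟨ω, hω, h⟩ := exists_sum_exp_le hB hB' S hs.le hs1 hX0 hX1 hXi hm N
  refine ⟨ω, hω, fun k hk => ?_⟩
  have h1 : Real.exp (s * ∑ i ∈ Finset.range N, (X i k (ω i) - (1 + s) * m i k)) ≤ S.card :=
    (Finset.single_le_sum (f := fun k =>
      Real.exp (s * ∑ i ∈ Finset.range N, (X i k (ω i) - (1 + s) * m i k)))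
      (fun _ _ => (Real.exp_pos _).le) hk).trans h
  have h2 := Real.log_le_log (Real.exp_pos _) h1
  rw [Real.log_exp, Finset.sum_sub_distrib, ← Finset.mul_sum, ← le_div_iff₀' hs] at h2
  linarith

/-! ### Cut-off translations on short intervals -/

/-- A trapezoidal bump supported in `[0, 1]` and equal to `1` on `[θ, 1 - θ]`. -/
noncomputable def plateau (θ x : ℝ) : ℝ := max 0 (min 1 (min (x / θ) ((1 - x) / θ)))

theorem plateau_nonneg (θ x : ℝ) : 0 ≤ plateau θ x := le_max_left _ _

theorem plateau_le_one (θ x : ℝ) : plateau θ x ≤ 1 := max_le zero_le_one (min_le_left _ _)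

theorem plateau_eq_zero {θ x : ℝ} (hθ : 0 < θ) (h : x ≤ 0 ∨ 1 ≤ x) : plateau θ x = 0 := by
  refine max_eq_left ((min_le_right _ _).trans ?_)
  rcases h with h | h
  · exact (min_le_left _ _).trans (div_nonpos_of_nonpos_of_nonneg h hθ.le)
  · exact (min_le_right _ _).trans (div_nonpos_of_nonpos_of_nonneg (by linarith) hθ.le)

theorem plateau_eq_one {θ x : ℝ} (hθ : 0 < θ) (h : θ ≤ x) (h' : x ≤ 1 - θ) : plateau θ x = 1 := by
  have h1 : 1 ≤ x / θ := by rwa [le_div_iff₀ hθ, one_mul]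
  have h2 : 1 ≤ (1 - x) / θ := by rw [le_div_iff₀ hθ, one_mul]; linarith
  rw [plateau, min_eq_left (le_min h1 h2)]
  exact max_eq_right zero_le_one

theorem abs_plateau_sub_le {θ : ℝ} (hθ : 0 < θ) (x y : ℝ) :
    |plateau θ x - plateau θ y| ≤ |x - y| / θ := by
  have h1 : LipschitzWith (Real.toNNReal θ⁻¹) fun x : ℝ => x / θ :=
    LipschitzWith.of_dist_le_mul fun x y => by
      rw [Real.coe_toNNReal _ (by positivity), Real.dist_eq, Real.dist_eq, ← sub_div, abs_div,
        abs_of_pos hθ, div_eq_inv_mul]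
  have h2 : LipschitzWith (Real.toNNReal θ⁻¹) fun x : ℝ => (1 - x) / θ :=
    LipschitzWith.of_dist_le_mul fun x y => by
      rw [Real.coe_toNNReal _ (by positivity), Real.dist_eq, Real.dist_eq, ← sub_div, abs_div,
        abs_of_pos hθ, div_eq_inv_mul, sub_sub_sub_cancel_left, abs_sub_comm]
  have h3 := ((h1.min h2).const_min 1).const_max 0
  have h4 := h3.dist_le_mul x y
  rw [max_self, Real.coe_toNNReal _ (by positivity), Real.dist_eq, Real.dist_eq,
    ← div_eq_inv_mul] at h4
  exact h4

/-- The shifted plateaus overlap at most at end points, where they vanish, so at most one term of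
`bump` is nonzero at any time. -/
theorem eq_floor_of_plateau_ne_zero {θ x : ℝ} (hθ : 0 < θ) {i : ℕ}
    (h : plateau θ (x - i) ≠ 0) : i = ⌊x⌋₊ := by
  by_contra hne
  apply h
  refine plateau_eq_zero hθ ?_
  by_contra! hcon
  refine hne (Eq.symm ((Nat.floor_eq_iff ?_).2 ⟨?_, ?_⟩)) <;>
  linarith [Nat.cast_nonneg (α := ℝ) i, hcon.1, hcon.2]

/-- On each of the intervals `[i / N, (i + 1) / N]` with `i < N`, a translation by `ω i`, cut off
near the end points. -/
noncomputable def bump (N : ℕ) (θ : ℝ) (ω : ℕ → Plane) (t : ℝ) : Plane :=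
  ∑ i ∈ Finset.range N, plateau θ (N * t - i) • ω i

theorem bump_zero (N : ℕ) {θ : ℝ} (hθ : 0 < θ) (ω : ℕ → Plane) : bump N θ ω 0 = 0 := by
  refine Finset.sum_eq_zero fun i _ => ?_
  rw [plateau_eq_zero hθ (Or.inl (by simp)), zero_smul]

theorem bump_eq {N : ℕ} {θ : ℝ} (hθ : 0 < θ) (ω : ℕ → Plane) {i : ℕ} (hi : i < N) {t : ℝ}
    (h : i + θ ≤ N * t) (h' : N * t ≤ i + 1 - θ) : bump N θ ω t = ω i := by
  have h1 : plateau θ (N * t - i) = 1 := plateau_eq_one hθ (by linarith) (by linarith)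
  rw [bump, Finset.sum_eq_single_of_mem i (Finset.mem_range.2 hi), h1, one_smul]
  intro j _ hj
  have : plateau θ (N * t - j) = 0 := by
    by_contra hne
    exact hj ((eq_floor_of_plateau_ne_zero hθ hne).trans
      (eq_floor_of_plateau_ne_zero hθ (by rw [h1]; exact one_ne_zero)).symm)
  rw [this, zero_smul]

theorem norm_bump_le (N : ℕ) {θ ρ : ℝ} (hθ : 0 < θ) (hρ : 0 ≤ ρ) {ω : ℕ → Plane}
    (hω : ∀ i, ‖ω i‖ ≤ ρ) (t : ℝ) : ‖bump N θ ω t‖ ≤ ρ := by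
  rw [bump]
  by_cases h : ⌊N * t⌋₊ ∈ Finset.range N
  · rw [Finset.sum_eq_single_of_mem _ h, norm_smul, Real.norm_of_nonneg (plateau_nonneg _ _)]
    · exact (mul_le_mul (plateau_le_one _ _) (hω _) (norm_nonneg _) zero_le_one).trans
        (one_mul ρ).le
    · intro j _ hj
      have : plateau θ (N * t - j) = 0 := by
        by_contra hne
        exact hj (eq_floor_of_plateau_ne_zero hθ hne)
      rw [this, zero_smul]
  · rw [Finset.sum_eq_zero, norm_zero]
    · exact hρ
    · intro j hj
      have : plateau θ (N * t - j) = 0 := by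
        by_contra hne
        exact h (eq_floor_of_plateau_ne_zero hθ hne ▸ hj)
      rw [this, zero_smul]

/-- Every summand has Lipschitz constant `ρ N / θ`, and at most two summands, one for each of the
two times, contribute to the difference: hence the factor `2`. -/
theorem norm_bump_sub_le (N : ℕ) {θ ρ : ℝ} (hθ : 0 < θ) (hρ : 0 ≤ ρ) {ω : ℕ → Plane}
    (hω : ∀ i, ‖ω i‖ ≤ ρ) (t u : ℝ) :
    ‖bump N θ ω t - bump N θ ω u‖ ≤ 2 * ρ * N / θ * |t - u| := by
  set b : ℝ := N * |t - u| / θ * ρ with hb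
  set a : ℕ → Plane := fun i => plateau θ (N * t - i) • ω i - plateau θ (N * u - i) • ω i with ha
  have hb0 : 0 ≤ b := by positivity
  have h1 : ∀ i, ‖a i‖ ≤ b := fun i => by
    simp only [ha]
    rw [← sub_smul, norm_smul, Real.norm_eq_abs]
    refine mul_le_mul ((abs_plateau_sub_le hθ _ _).trans_eq ?_) (hω i) (norm_nonneg _)
      (by positivity)
    rw [sub_sub_sub_cancel_right, ← mul_sub, abs_mul, Nat.abs_cast]
  have h2 : {i ∈ Finset.range N | a i ≠ 0} ⊆ {⌊N * t⌋₊, ⌊N * u⌋₊} := by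
    intro i hi
    have hi' := (Finset.mem_filter.1 hi).2
    rw [Finset.mem_insert, Finset.mem_singleton]
    by_contra! hcon
    apply hi'
    have e1 : plateau θ (N * t - i) = 0 := by
      by_contra hne
      exact hcon.1 (eq_floor_of_plateau_ne_zero hθ hne)
    have e2 : plateau θ (N * u - i) = 0 := by
      by_contra hne
      exact hcon.2 (eq_floor_of_plateau_ne_zero hθ hne)
    simp [ha, e1, e2]
  have h3 : bump N θ ω t - bump N θ ω u = ∑ i ∈ {i ∈ Finset.range N | a i ≠ 0}, a i := by
    rw [Finset.sum_filter_ne_zero, bump, bump, ← Finset.sum_sub_distrib]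
  rw [h3]
  calc ‖∑ i ∈ {i ∈ Finset.range N | a i ≠ 0}, a i‖
      ≤ ∑ i ∈ {i ∈ Finset.range N | a i ≠ 0}, ‖a i‖ := norm_sum_le _ _
    _ ≤ ({i ∈ Finset.range N | a i ≠ 0}).card • b := Finset.sum_le_card_nsmul _ _ _ fun i _ => h1 i
    _ ≤ 2 • b := nsmul_le_nsmul_left hb0 ((Finset.card_le_card h2).trans Finset.card_le_two)
    _ = 2 * ρ * N / θ * |t - u| := by rw [hb, two_nsmul]; ring

theorem continuous_bump (N : ℕ) (θ : ℝ) (ω : ℕ → Plane) : Continuous (bump N θ ω) := by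
  unfold bump plateau
  fun_prop

theorem intervalIntegrable_of_mem_unitInterval {h : ℝ → ℝ} (hm : Measurable h) (h0 : ∀ t, 0 ≤ h t)
    (h1 : ∀ t, h t ≤ 1) (a b : ℝ) : IntervalIntegrable h volume a b := by
  rw [intervalIntegrable_iff]
  refine Measure.integrableOn_of_bounded (M := 1) (by simp) hm.aestronglyMeasurable ?_
  exact Filter.Eventually.of_forall fun t => by
    rw [Real.norm_of_nonneg (h0 t)]; exact h1 t

theorem integral_le_length {h : ℝ → ℝ} (hm : Measurable h) (h0 : ∀ t, 0 ≤ h t)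
    (h1 : ∀ t, h t ≤ 1) {a b : ℝ} (hab : a ≤ b) : ∫ t in a..b, h t ≤ b - a := by
  have := intervalIntegral.integral_mono_on hab
    (intervalIntegrable_of_mem_unitInterval hm h0 h1 a b)
    (intervalIntegrable_const (c := (1 : ℝ))) fun t _ => h1 t
  simpa using this

/-! ### Change of scale against finitely many isometries -/

/-- Perturbing `f` by translations on `N` short intervals: for finitely many isometries at once,
the average of the density along the curve hardly increases when passing to a smaller scale. -/
theorem exists_bump_integral_density_le {U : Set Plane} (hU : MeasurableSet U) {f : ℝ → Plane}
    (hf : Continuous f) {R ρ r : ℝ} (hρ : 0 < ρ) (hr : 0 < r) (hR : ρ + r ≤ R)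
    (S : Finset (Plane ≃ᵢ Plane)) {N : ℕ} (hN : 0 < N) {θ s η : ℝ} (hθ : 0 < θ) (hθ1 : θ ≤ 1 / 2)
    (hs : 0 < s) (hs1 : s ≤ 1)
    (hη : ∀ ι ∈ S, ∫ t in (0 : ℝ)..1, density U R (ι (f t)) ≤ η) :
    ∃ ω : ℕ → Plane, (∀ i, ‖ω i‖ ≤ ρ) ∧ ∀ ι ∈ S,
      ∫ t in (0 : ℝ)..1, density U r (ι (f t + bump N θ ω t)) ≤
        (1 + s) * ((R / ρ) ^ 2 * η) + Real.log S.card / (s * N) + 2 * θ := by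
  have hN' : (0 : ℝ) < N := Nat.cast_pos.2 hN
  set a : ℕ → ℝ := fun i => i / N with ha
  have haa : ∀ i, a i ≤ a (i + 1) := fun i => by
    simp only [ha]; gcongr; simp
  have ha1 : ∀ i, a (i + 1) - a i = 1 / N := fun i => by
    simp only [ha]; push_cast; ring
  have hRpos : 0 < R := by linarith
  have hmeas : ∀ {R : ℝ} (ι : Plane ≃ᵢ Plane) {g : ℝ → Plane}, Continuous g →
      Measurable fun t => density U R (ι (g t)) := fun ι g hg =>
    (measurable_density hU _).comp (ι.continuous.comp hg).measurable
  have hint : ∀ {R : ℝ} (_ : 0 < R) (ι : Plane ≃ᵢ Plane) {g : ℝ → Plane} (_ : Continuous g)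
      (a b : ℝ), IntervalIntegrable (fun t => density U R (ι (g t))) volume a b :=
    fun hR ι g hg => intervalIntegrable_of_mem_unitInterval (hmeas ι hg)
      (fun _ => density_nonneg _ _ _) (fun _ => density_le_one _ hR _)
  have hsum : ∀ {R : ℝ} (_ : 0 < R) (ι : Plane ≃ᵢ Plane) {g : ℝ → Plane} (_ : Continuous g),
      ∑ i ∈ Finset.range N, ∫ t in a i..a (i + 1), density U R (ι (g t)) =
        ∫ t in (0 : ℝ)..1, density U R (ι (g t)) := fun hR ι g hg => by
    rw [intervalIntegral.sum_integral_adjacent_intervals fun k _ => hint hR ι hg _ _]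
    simp [ha, hN'.ne']
  -- The factor `N` normalizes the integral over an interval of length `1 / N` to a quantity in `[0,
  -- 1]`, as the selection lemma demands.
  set X : ℕ → (Plane ≃ᵢ Plane) → Plane → ℝ := fun i ι ω =>
    N * ∫ t in a i..a (i + 1), density U r (ι (f t + ω)) with hX
  set m : ℕ → (Plane ≃ᵢ Plane) → ℝ := fun i ι =>
    N * ((R / ρ) ^ 2 * ∫ t in a i..a (i + 1), density U R (ι (f t))) with hm
  have hprod : ∀ i (ι : Plane ≃ᵢ Plane), Integrable
      (Function.uncurry fun t ω => density U r (ι (f t + ω)))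
      ((volume.restrict (Set.uIoc (a i) (a (i + 1)))).prod (volume.restrict (ball (0 : Plane) ρ))) :=
    fun i ι => by
      have : IsFiniteMeasure (volume.restrict (ball (0 : Plane) ρ)) :=
        isFiniteMeasure_restrict.2 measure_ball_lt_top.ne
      have : IsFiniteMeasure (volume.restrict (Set.uIoc (a i) (a (i + 1)))) :=
        ⟨by simp⟩
      refine Integrable.of_bound (C := 1) ?_ (Filter.Eventually.of_forall fun q => ?_)
      · refine Measurable.aestronglyMeasurable ?_
        refine (measurable_density hU r).comp (ι.continuous.comp ?_).measurable
        fun_prop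
      · exact (Real.norm_of_nonneg (density_nonneg _ _ _)).trans_le (density_le_one _ hr _)
  have hXi : ∀ i ι, IntegrableOn (X i ι) (ball 0 ρ) volume := fun i ι => by
    have := (hprod i ι).integral_prod_right
    simp only [hX, intervalIntegral.integral_of_le (haa i)]
    rw [Set.uIoc_of_le (haa i)] at this
    exact this.const_mul _
  have hXm : ∀ i ι, ⨍ ω in ball (0 : Plane) ρ, X i ι ω ≤ m i ι := fun i ι => by
    simp only [hX, hm]
    rw [setAverage_eq, integral_const_mul, ← intervalIntegral_integral_swap (hprod i ι),
      smul_eq_mul, mul_left_comm]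
    refine mul_le_mul_of_nonneg_left ?_ hN'.le
    rw [← intervalIntegral.integral_const_mul, ← intervalIntegral.integral_const_mul]
    refine intervalIntegral.integral_mono_on (haa i) ?_ ((hint hRpos ι hf _ _).const_mul _) ?_
    · rw [intervalIntegrable_iff]
      exact ((hprod i ι).integral_prod_left).const_mul _
    · intro t _
      have := setAverage_density_le hU hρ hr hR ι (f t)
      rwa [setAverage_eq, smul_eq_mul] at this
  obtain ⟨ω, hω, hle⟩ := exists_forall_sum_le (μ := (volume : Measure Plane)) (B := ball 0 ρ)
    (measure_ball_pos _ _ hρ).ne' measure_ball_lt_top.ne S hs hs1 (X := X) (m := m)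
    (fun i ι ω => mul_nonneg hN'.le (intervalIntegral.integral_nonneg (haa i)
      fun t _ => density_nonneg _ _ _))
    (fun i ι ω => by
      have := integral_le_length (hmeas (R := r) ι (hf.add (continuous_const (y := ω))))
        (fun _ => density_nonneg _ _ _) (fun _ => density_le_one _ hr _) (haa i)
      rw [ha1] at this
      simp only [hX]
      calc _ ≤ (N : ℝ) * (1 / N) := mul_le_mul_of_nonneg_left this hN'.le
        _ = 1 := by field_simp) hXi hXm N
  refine ⟨ω, fun i => (mem_ball_zero_iff.1 (hω i)).le, fun ι hι => ?_⟩
  have hg : Continuous fun t => f t + bump N θ ω t := hf.add (continuous_bump N θ ω)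
  -- On the middle of the `i`-th interval the perturbation is exactly the translation by `ω i`; the
  -- two end pieces, of length `θ / N` each, are estimated by density at most `1`.
  have hpiece : ∀ i ∈ Finset.range N,
      ∫ t in a i..a (i + 1), density U r (ι (f t + bump N θ ω t)) ≤
        X i ι (ω i) / N + 2 * θ / N := fun i hi => by
    have hiN := Finset.mem_range.1 hi
    set b := a i + θ / N with hb
    set c := a (i + 1) - θ / N with hc
    have hθN : 0 < θ / N := by positivity
    have hbc : b ≤ c := by
      have : θ / N + θ / N ≤ 1 / N := by rw [← add_div]; gcongr; linarith
      linarith [ha1 i]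
    have hI := hint hr ι hg
    have hI' := hint hr ι (hf.add (continuous_const (y := ω i)))
    have e1 : ∫ t in a i..b, density U r (ι (f t + bump N θ ω t)) ≤ θ / N := by
      have := integral_le_length (hmeas (R := r) ι hg) (fun _ => density_nonneg _ _ _)
        (fun _ => density_le_one _ hr _) (show a i ≤ b by linarith)
      linarith
    have e3 : ∫ t in c..a (i + 1), density U r (ι (f t + bump N θ ω t)) ≤ θ / N := by
      have := integral_le_length (hmeas (R := r) ι hg) (fun _ => density_nonneg _ _ _)
        (fun _ => density_le_one _ hr _) (show c ≤ a (i + 1) by linarith)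
      linarith
    have e2 : ∫ t in b..c, density U r (ι (f t + bump N θ ω t)) =
        ∫ t in b..c, density U r (ι (f t + ω i)) := by
      refine intervalIntegral.integral_congr fun t ht => ?_
      rw [Set.uIcc_of_le hbc] at ht
      have hb' : (N : ℝ) * b = i + θ := by simp only [hb, ha]; field_simp
      have hc' : (N : ℝ) * c = i + 1 - θ := by simp only [hc, ha]; push_cast; field_simp
      have h1 := mul_le_mul_of_nonneg_left ht.1 hN'.le
      have h2 := mul_le_mul_of_nonneg_left ht.2 hN'.le
      simp only [bump_eq hθ ω hiN (hb' ▸ h1) (hc' ▸ h2)]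
    have e4 : ∫ t in b..c, density U r (ι (f t + ω i)) ≤
        ∫ t in a i..a (i + 1), density U r (ι (f t + ω i)) :=
      intervalIntegral.integral_mono_interval (by linarith) hbc (by linarith)
        (Filter.Eventually.of_forall fun _ => density_nonneg _ _ _) (hI' _ _)
    have e5 : X i ι (ω i) / N = ∫ t in a i..a (i + 1), density U r (ι (f t + ω i)) := by
      simp only [hX]; field_simp
    rw [← intervalIntegral.integral_add_adjacent_intervals (hI (a i) b) (hI b _),
      ← intervalIntegral.integral_add_adjacent_intervals (hI b c) (hI c _), e2, e5]
    have e6 : 2 * θ / N = θ / N + θ / N := by ring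
    linarith
  calc ∫ t in (0 : ℝ)..1, density U r (ι (f t + bump N θ ω t))
      = ∑ i ∈ Finset.range N, ∫ t in a i..a (i + 1), density U r (ι (f t + bump N θ ω t)) :=
        (hsum hr ι hg).symm
    _ ≤ ∑ i ∈ Finset.range N, (X i ι (ω i) / N + 2 * θ / N) := Finset.sum_le_sum hpiece
    _ = (∑ i ∈ Finset.range N, X i ι (ω i)) / N + 2 * θ := by
        rw [Finset.sum_add_distrib, Finset.sum_div, Finset.sum_const, Finset.card_range,
          nsmul_eq_mul]
        congr 1
        field_simp
    _ ≤ ((1 + s) * ∑ i ∈ Finset.range N, m i ι + Real.log S.card / s) / N + 2 * θ := by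
        gcongr
        exact hle ι hι
    _ = (1 + s) * ((R / ρ) ^ 2 * ∫ t in (0 : ℝ)..1, density U R (ι (f t))) +
          Real.log S.card / (s * N) + 2 * θ := by
        simp only [hm]
        rw [← Finset.mul_sum, ← Finset.mul_sum, hsum hRpos ι hf]
        field_simp
    _ ≤ _ := by
        gcongr
        exact hη ι hι

/-! ### Isometries modulo integer translations -/

/-- The points of the plane with integer coordinates. -/
noncomputable def latticeVec (z : Fin 2 → ℤ) : Plane := WithLp.toLp 2 fun i => (z i : ℝ)

@[simp]
theorem latticeVec_apply (z : Fin 2 → ℤ) (i : Fin 2) : latticeVec z i = z i := rfl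

theorem latticeVec_add (z z' : Fin 2 → ℤ) :
    latticeVec (z + z') = latticeVec z + latticeVec z' := by
  ext i; simp

theorem latticeVec_neg (z : Fin 2 → ℤ) : latticeVec (-z) = -latticeVec z := by
  ext i; simp

theorem norm_plane_le (x : Plane) : ‖x‖ ≤ |x 0| + |x 1| := by
  rw [EuclideanSpace.norm_eq, Fin.sum_univ_two, Real.norm_eq_abs, Real.norm_eq_abs]
  refine Real.sqrt_le_iff.2 ⟨by positivity, ?_⟩
  nlinarith [abs_nonneg (x 0), abs_nonneg (x 1)]

theorem abs_apply_le_norm (x : Plane) (i : Fin 2) : |x i| ≤ ‖x‖ :=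
  PiLp.norm_apply_le x i

/-- The coordinate vectors of the plane. -/
noncomputable def coordVec (i : Fin 2) : Plane := EuclideanSpace.single i 1

theorem norm_coordVec (i : Fin 2) : ‖coordVec i‖ = 1 := by simp [coordVec]

/-- A surjective isometry of the plane is affine (Mazur–Ulam), so the images of three points
determine it. -/
theorem isometryEquiv_apply_eq (ι : Plane ≃ᵢ Plane) (x : Plane) :
    ι x = ι 0 + x 0 • (ι (coordVec 0) - ι 0) + x 1 • (ι (coordVec 1) - ι 0) := by
  set A := ι.toRealAffineIsometryEquiv with hA
  have h : ∀ y, ι y - ι 0 = A.linearIsometryEquiv y := fun y => by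
    have := A.map_vadd 0 y
    rw [hA, IsometryEquiv.coeFn_toRealAffineIsometryEquiv] at this
    simp only [vadd_eq_add, add_zero] at this
    rw [this, add_sub_cancel_right]
  have hx : x = x 0 • coordVec 0 + x 1 • coordVec 1 := by
    ext i; fin_cases i <;> simp [coordVec]
  rw [h, h, ← map_smul, ← map_smul, add_assoc, ← map_add, ← hx, ← h, add_sub_cancel]

/-- The integer vector which moves the image of the origin into the unit square. -/
noncomputable def cellShift (ι : Plane ≃ᵢ Plane) : Fin 2 → ℤ := fun i => -⌊ι 0 i⌋

/-- Six numbers determining an isometry modulo integer translations. -/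
noncomputable def isometryData (ι : Plane ≃ᵢ Plane) (q : Fin 3 × Fin 2) : ℝ :=
  (![ι 0 + latticeVec (cellShift ι), ι (coordVec 0) - ι 0, ι (coordVec 1) - ι 0] q.1 : Plane) q.2

theorem abs_isometryData_le (ι : Plane ≃ᵢ Plane) (q : Fin 3 × Fin 2) :
    |isometryData ι q| ≤ 1 := by
  obtain ⟨i, j⟩ := q
  have h : ∀ k, |(ι (coordVec k) - ι 0) j| ≤ 1 := fun k => by
    refine (abs_apply_le_norm _ _).trans ?_
    rw [← dist_eq_norm, ι.dist_eq, dist_zero_right, norm_coordVec]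
  fin_cases i
  · have h1 := Int.fract_nonneg (ι 0 j)
    have h2 := (Int.fract_lt_one (ι 0 j)).le
    have h3 : isometryData ι (0, j) = Int.fract (ι 0 j) := by
      simp [isometryData, cellShift, Int.fract, sub_eq_add_neg]
    change |isometryData ι (0, j)| ≤ 1
    rw [h3, abs_of_nonneg h1]
    exact h2
  · exact h 0
  · exact h 1

/-- Each of the three vectors encoded in the data moves by at most `2 ε`; they enter with
coefficients bounded by `1`, `4` and `4`. -/
theorem dist_le_of_isometryData {ι ι' : Plane ≃ᵢ Plane} {ε : ℝ}
    (h : ∀ q, |isometryData ι q - isometryData ι' q| ≤ ε) {x : Plane} (hx : ‖x‖ ≤ 4) :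
    dist (ι x + latticeVec (cellShift ι)) (ι' x + latticeVec (cellShift ι')) ≤ 18 * ε := by
  have hv : ∀ i : Fin 3, ∀ v w : Plane, (∀ j, v j - w j = isometryData ι (i, j) -
      isometryData ι' (i, j)) → ‖v - w‖ ≤ 2 * ε := fun i v w hvw => by
    refine (norm_plane_le _).trans ?_
    have h0 := h (i, 0)
    have h1 := h (i, 1)
    rw [← hvw] at h0 h1
    rw [PiLp.sub_apply, PiLp.sub_apply]
    linarith
  have h0 := hv 0 (ι 0 + latticeVec (cellShift ι)) (ι' 0 + latticeVec (cellShift ι')) fun _ => rfl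
  have h1 := hv 1 (ι (coordVec 0) - ι 0) (ι' (coordVec 0) - ι' 0) fun _ => rfl
  have h2 := hv 2 (ι (coordVec 1) - ι 0) (ι' (coordVec 1) - ι' 0) fun _ => rfl
  have hε : 0 ≤ ε := (abs_nonneg _).trans (h 0)
  rw [dist_eq_norm, isometryEquiv_apply_eq ι x, isometryEquiv_apply_eq ι' x]
  have hx0 := (abs_apply_le_norm x 0).trans hx
  have hx1 := (abs_apply_le_norm x 1).trans hx
  set u := ι 0 + latticeVec (cellShift ι)
  set u' := ι' 0 + latticeVec (cellShift ι')
  set v := ι (coordVec 0) - ι 0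
  set v' := ι' (coordVec 0) - ι' 0
  set w := ι (coordVec 1) - ι 0
  set w' := ι' (coordVec 1) - ι' 0
  have e : ι 0 + x 0 • v + x 1 • w + latticeVec (cellShift ι) -
      (ι' 0 + x 0 • v' + x 1 • w' + latticeVec (cellShift ι')) =
      (u - u') + x 0 • (v - v') + x 1 • (w - w') := by
    have hu : u = ι 0 + latticeVec (cellShift ι) := rfl
    have hu' : u' = ι' 0 + latticeVec (cellShift ι') := rfl
    rw [hu, hu']
    module
  rw [e]
  have n1 : ‖x 0 • (v - v')‖ ≤ 4 * (2 * ε) := by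
    rw [norm_smul, Real.norm_eq_abs]
    exact mul_le_mul hx0 h1 (norm_nonneg _) (by norm_num)
  have n2 : ‖x 1 • (w - w')‖ ≤ 4 * (2 * ε) := by
    rw [norm_smul, Real.norm_eq_abs]
    exact mul_le_mul hx1 h2 (norm_nonneg _) (by norm_num)
  linarith [norm_add_le (u - u' + x 0 • (v - v')) (x 1 • (w - w')),
    norm_add_le (u - u') (x 0 • (v - v'))]

/-- Modulo integer translations, the isometries have a `τ`-net of size polynomial in `1 / τ`. -/
theorem exists_isometry_net {τ : ℝ} (hτ : 0 < τ) (hτ1 : τ ≤ 1) :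
    ∃ S : Finset (Plane ≃ᵢ Plane), (S.card : ℝ) ≤ (41 / τ) ^ 6 ∧
      ∀ ι : Plane ≃ᵢ Plane, ∃ ι' ∈ S, ∃ z : Fin 2 → ℤ, ∀ x : Plane, ‖x‖ ≤ 4 →
        dist (ι x + latticeVec z) (ι' x) ≤ τ := by
  classical
  -- The data are rounded to a grid of mesh `1 / K`; two isometries with equal codes are then `18 /
  -- K ≤ τ` close.
  obtain ⟨K, hK, hK'⟩ : ∃ K : ℕ, 18 / τ ≤ K ∧ (K : ℝ) ≤ 19 / τ := by
    refine ⟨⌈18 / τ⌉₊, Nat.le_ceil _, (Nat.ceil_lt_add_one (by positivity)).le.trans ?_⟩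
    have : 1 ≤ 1 / τ := by rwa [le_div_iff₀ hτ, one_mul]
    calc 18 / τ + 1 ≤ 18 / τ + 1 / τ := by gcongr
      _ = 19 / τ := by ring
  have hK0 : (0 : ℝ) < K := lt_of_lt_of_le (by positivity) hK
  set code : (Plane ≃ᵢ Plane) → Fin 3 × Fin 2 → ℤ := fun ι q => ⌊K * isometryData ι q⌋ with hcode
  set C : Finset (Fin 3 × Fin 2 → ℤ) := Fintype.piFinset fun _ => Finset.Icc (-K : ℤ) K with hC
  have hmem : ∀ ι, code ι ∈ C := fun ι => by
    rw [hC, Fintype.mem_piFinset]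
    intro q
    have h := abs_le.1 (abs_isometryData_le ι q)
    rw [Finset.mem_Icc]
    constructor
    · rw [hcode, Int.le_floor]; push_cast; nlinarith
    · have : ((⌊K * isometryData ι q⌋ : ℤ) : ℝ) ≤ (K : ℤ) :=
        (Int.floor_le _).trans (by push_cast; nlinarith)
      exact_mod_cast this
  -- One isometry per occupied grid cell; the value on empty cells plays no role.
  set rep : (Fin 3 × Fin 2 → ℤ) → (Plane ≃ᵢ Plane) := fun c =>
    if h : ∃ ι, code ι = c then h.choose else IsometryEquiv.refl _ with hrep
  have hrep' : ∀ ι, code (rep (code ι)) = code ι := fun ι => by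
    have h : ∃ ι', code ι' = code ι := ⟨ι, rfl⟩
    simp only [hrep, dif_pos h]
    exact h.choose_spec
  refine ⟨C.image rep, ?_, fun ι => ⟨rep (code ι), Finset.mem_image_of_mem _ (hmem ι),
    cellShift ι - cellShift (rep (code ι)), fun x hx => ?_⟩⟩
  · have h1 : (C.image rep).card ≤ (2 * K + 1) ^ 6 := by
      refine Finset.card_image_le.trans ?_
      rw [hC, Fintype.card_piFinset]
      simp only [Int.card_Icc, Finset.prod_const, Finset.card_univ, Fintype.card_prod,
        Fintype.card_fin]
      refine (Nat.pow_le_pow_left ?_ _)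
      omega
    calc ((C.image rep).card : ℝ) ≤ ((2 * K + 1 : ℕ) : ℝ) ^ 6 := by exact_mod_cast h1
      _ ≤ (41 / τ) ^ 6 := by
        gcongr
        push_cast
        have : 1 ≤ 1 / τ := by rwa [le_div_iff₀ hτ, one_mul]
        have e : 41 / τ = 2 * (19 / τ) + 3 * (1 / τ) := by ring
        linarith
  · have h2 : ∀ q, |isometryData ι q - isometryData (rep (code ι)) q| ≤ 1 / K := fun q => by
      have h3 : ⌊K * isometryData ι q⌋ = ⌊K * isometryData (rep (code ι)) q⌋ :=
        (congrFun (hrep' ι) q).symm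
      have h4 := (Int.abs_sub_lt_one_of_floor_eq_floor h3).le
      rw [← mul_sub, abs_mul, Nat.abs_cast] at h4
      rwa [le_div_iff₀' hK0]
    have h5 := dist_le_of_isometryData h2 hx
    have h6 : 18 * (1 / (K : ℝ)) ≤ τ := by
      rw [div_le_iff₀ hτ] at hK
      rw [mul_one_div, div_le_iff₀ hK0]; linarith
    refine le_trans (le_of_eq ?_) (h5.trans h6)
    rw [sub_eq_add_neg, latticeVec_add, latticeVec_neg, dist_eq_norm, dist_eq_norm]
    congr 1
    abel

/-! ### Periodization -/

/-- The union of all integer translates of a set. -/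
def periodization (V : Set Plane) : Set Plane := ⋃ z : Fin 2 → ℤ, (· + latticeVec z) ⁻¹' V

theorem subset_periodization (V : Set Plane) : V ⊆ periodization V := fun x hx =>
  Set.mem_iUnion.2 ⟨0, by
    have : latticeVec 0 = 0 := by ext i; simp
    simpa [this] using hx⟩

theorem isOpen_periodization {V : Set Plane} (hV : IsOpen V) : IsOpen (periodization V) :=
  isOpen_iUnion fun z => hV.preimage (by fun_prop)

theorem add_latticeVec_mem_periodization {V : Set Plane} {x : Plane} (z : Fin 2 → ℤ) :
    x + latticeVec z ∈ periodization V ↔ x ∈ periodization V := by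
  simp only [periodization, Set.mem_iUnion, Set.mem_preimage]
  constructor
  · rintro ⟨w, hw⟩
    exact ⟨z + w, by rwa [latticeVec_add, ← add_assoc]⟩
  · rintro ⟨w, hw⟩
    refine ⟨-z + w, ?_⟩
    rwa [latticeVec_add, latticeVec_neg, ← add_assoc, add_neg_cancel_right]

theorem density_periodization_add (V : Set Plane) (R : ℝ) (y : Plane) (z : Fin 2 → ℤ) :
    density (periodization V) R (y + latticeVec z) = density (periodization V) R y := by
  have h : (· + latticeVec z) ⁻¹' (periodization V ∩ ball (y + latticeVec z) R) =
      periodization V ∩ ball y R := by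
    ext x
    simp [add_latticeVec_mem_periodization]
  unfold density Measure.real
  rw [← h, measure_preimage_add_right]

/-- Each coordinate of `z` lies in a closed interval of length `6`, which contains at most `7`
integers. -/
theorem count_latticeVec_mem_ball_le (a w : Plane) :
    Measure.count {z : Fin 2 → ℤ | w ∈ ball (a + latticeVec z) 3} ≤ 49 := by
  set C : Finset (Fin 2 → ℤ) := Fintype.piFinset fun i =>
    Finset.Icc ⌈w i - a i - 3⌉ ⌊w i - a i + 3⌋ with hC
  have h1 : {z : Fin 2 → ℤ | w ∈ ball (a + latticeVec z) 3} ⊆ C := fun z hz => by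
    have hz' : dist w (a + latticeVec z) < 3 := hz
    rw [hC, Finset.mem_coe, Fintype.mem_piFinset]
    intro i
    rw [dist_eq_norm] at hz'
    have h := abs_lt.1 ((abs_apply_le_norm _ i).trans_lt hz')
    simp only [PiLp.sub_apply, PiLp.add_apply, latticeVec_apply] at h
    rw [Finset.mem_Icc, Int.ceil_le, Int.le_floor]
    constructor <;> linarith
  have h2 : C.card ≤ 49 := by
    rw [hC, Fintype.card_piFinset, Fin.prod_univ_two]
    have h3 : ∀ i : Fin 2, (Finset.Icc ⌈w i - a i - 3⌉ ⌊w i - a i + 3⌋).card ≤ 7 := fun i => by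
      rw [Int.card_Icc]
      have h4 := Int.floor_le (w i - a i + 3)
      have h5 := Int.le_ceil (w i - a i - 3)
      have h6 : ⌊w i - a i + 3⌋ ≤ ⌈w i - a i - 3⌉ + 6 := by
        have : (⌊w i - a i + 3⌋ : ℝ) ≤ ((⌈w i - a i - 3⌉ + 6 : ℤ) : ℝ) := by push_cast; linarith
        exact_mod_cast this
      omega
    exact Nat.mul_le_mul (h3 0) (h3 1)
  refine (measure_mono h1).trans ?_
  rw [Measure.count_apply_finset]
  exact_mod_cast h2

/-- Tonelli against counting measure: a point of `V` is counted once for each translate of the ball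
containing it, so at most `49` times. -/
theorem volume_periodization_inter_ball_le {V : Set Plane} (hV : MeasurableSet V) (a : Plane) :
    volume (periodization V ∩ ball a 3) ≤ 49 * volume V := by
  have h1 : periodization V ∩ ball a 3 =
      ⋃ z : Fin 2 → ℤ, (· + latticeVec z) ⁻¹' (V ∩ ball (a + latticeVec z) 3) := by
    rw [periodization, Set.iUnion_inter]
    refine Set.iUnion_congr fun z => ?_
    ext x
    simp
  rw [h1]
  calc _ ≤ ∑' z : Fin 2 → ℤ, volume ((· + latticeVec z) ⁻¹' (V ∩ ball (a + latticeVec z) 3)) :=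
        measure_iUnion_le _
    _ = ∑' z : Fin 2 → ℤ, volume (V ∩ ball (a + latticeVec z) 3) := by
        congr 1; ext z; rw [measure_preimage_add_right]
    _ = ∫⁻ z : Fin 2 → ℤ, volume (V ∩ ball (a + latticeVec z) 3) ∂Measure.count :=
        (lintegral_count _).symm
    _ = ∫⁻ w in V, Measure.count {z : Fin 2 → ℤ | w ∈ ball (a + latticeVec z) 3} :=
        lintegral_volume_inter_ball _ hV 3 (measurable_of_countable _)
    _ ≤ ∫⁻ _ in V, 49 := lintegral_mono fun w => count_latticeVec_mem_ball_le a w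
    _ = 49 * volume V := by rw [setLIntegral_const]

/-! ### Change of scale for all isometries at once -/

theorem measurable_density_comp {U : Set Plane} (hU : MeasurableSet U) (R : ℝ)
    (ι : Plane ≃ᵢ Plane) {g : ℝ → Plane} (hg : Continuous g) :
    Measurable fun t => density U R (ι (g t)) :=
  (measurable_density hU R).comp (ι.continuous.comp hg).measurable

theorem intervalIntegrable_density_comp {U : Set Plane} (hU : MeasurableSet U) {R : ℝ} (hR : 0 < R)
    (ι : Plane ≃ᵢ Plane) {g : ℝ → Plane} (hg : Continuous g) (a b : ℝ) :
    IntervalIntegrable (fun t => density U R (ι (g t))) volume a b :=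
  intervalIntegrable_of_mem_unitInterval (measurable_density_comp hU R ι hg)
    (fun _ => density_nonneg _ _ _) (fun _ => density_le_one _ hR _) a b

/-- One step of the multiscale construction: a small Lipschitz perturbation of `f` keeps the mean
density along all congruent copies of the curve under control when passing from scale `R` to `r`. -/
theorem exists_refinement {V : Set Plane} (hV : IsOpen V) {f : ℝ → Plane} (hf : Continuous f)
    (hfb : ∀ t ∈ Set.Icc (0 : ℝ) 1, ‖f t‖ ≤ 3) {R r s d κ η : ℝ} (hR : 0 < R) (hR1 : R ≤ 1)
    (hr : 0 < r) (hs : 0 < s) (hs1 : s ≤ 1) (hd : 0 < d) (hd1 : d ≤ 1) (hrR : 4 * r ≤ s * R)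
    (hN : 12 / (s * d) * Real.log (41 / (s * r)) + 1 ≤ κ * d / (8 * R))
    (hη : ∀ ι : Plane ≃ᵢ Plane,
      ∫ t in (0 : ℝ)..1, density (periodization V) R (ι (f t)) ≤ η) :
    ∃ u : ℝ → Plane, u 0 = 0 ∧ (∀ t, ‖u t‖ ≤ R) ∧ (∀ t t', ‖u t - u t'‖ ≤ κ * |t - t'|) ∧
      ∀ ι : Plane ≃ᵢ Plane, ∫ t in (0 : ℝ)..1, density (periodization V) r (ι (f t + u t)) ≤
        (1 + s) ^ 5 * (η + d) := by
  have hU : MeasurableSet (periodization V) := (isOpen_periodization hV).measurableSet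
  -- Chosen so that `R / ρ = 1 + s`. The remaining room `R - ρ = s R / (1 + s)` holds the radius `(1
  -- + s) r`, since `(1 + s)² ≤ 4` and `4 r ≤ s R`.
  set ρ := R / (1 + s) with hρ
  have hρ0 : 0 < ρ := by positivity
  have hρR : ρ ≤ R := div_le_self hR.le (by linarith)
  have hr1 : r ≤ 1 := by nlinarith
  have hτ0 : 0 < s * r := by positivity
  have hτ1 : s * r ≤ 1 := by nlinarith
  have hscale : ρ + (1 + s) * r ≤ R := by
    rw [hρ, ← le_sub_iff_add_le', sub_div' (by positivity), le_div_iff₀ (by positivity)]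
    have : (1 + s) * (1 + s) ≤ 4 := by nlinarith
    nlinarith
  obtain ⟨S, hScard, hS⟩ := exists_isometry_net hτ0 hτ1
  set L := Real.log (41 / (s * r)) with hL
  have hL0 : 0 < L := Real.log_pos (by rw [lt_div_iff₀ hτ0]; linarith)
  -- The net has at most `exp (6 L)` elements, so this `N` makes the union cost at most `d / 2`;
  -- with `θ = d / 4` the end pieces cost another `d / 2`.
  set N := ⌈12 / (s * d) * L⌉₊ with hNdef
  have hNpos : 0 < N := Nat.ceil_pos.2 (by positivity)
  have hN' : (0 : ℝ) < N := Nat.cast_pos.2 hNpos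
  have hNle : 12 / (s * d) * L ≤ N := Nat.le_ceil _
  have hNle' : (N : ℝ) ≤ κ * d / (8 * R) :=
    (Nat.ceil_lt_add_one (by positivity)).le.trans hN
  obtain ⟨ω, hω, hbound⟩ := exists_bump_integral_density_le hU hf hρ0 (r := (1 + s) * r)
    (by positivity) hscale S hNpos (θ := d / 4) (by positivity) (by linarith) hs hs1
    (fun ι _ => hη ι)
  have hlog : Real.log S.card / (s * N) ≤ d / 2 := by
    have h1 : Real.log S.card ≤ 6 * L := by
      obtain ⟨ι', hι', -⟩ := hS (IsometryEquiv.refl _)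
      have hpos : (0 : ℝ) < S.card := Nat.cast_pos.2 (Finset.card_pos.2 ⟨ι', hι'⟩)
      have := Real.log_le_log hpos hScard
      rwa [Real.log_pow] at this
    rw [div_mul_eq_mul_div, div_le_iff₀ (by positivity)] at hNle
    rw [div_le_iff₀ (by positivity)]
    linarith
  have hu := norm_bump_le N (θ := d / 4) (by positivity) hρ0.le hω
  refine ⟨bump N (d / 4) ω, bump_zero N (by positivity) ω, fun t => (hu t).trans hρR,
    fun t t' => ?_, fun ι => ?_⟩
  · refine (norm_bump_sub_le N (by positivity) hρ0.le hω t t').trans ?_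
    refine mul_le_mul_of_nonneg_right ?_ (abs_nonneg _)
    rw [le_div_iff₀ (by positivity)] at hNle'
    rw [div_le_iff₀ (by positivity)]
    nlinarith
  · obtain ⟨ι', hι', z, hz⟩ := hS ι
    have hg : Continuous fun t => f t + bump N (d / 4) ω t := hf.add (continuous_bump _ _ _)
    have hsr : (1 + s) * r / r = 1 + s := by field_simp
    calc ∫ t in (0 : ℝ)..1, density (periodization V) r (ι (f t + bump N (d / 4) ω t))
        ≤ ∫ t in (0 : ℝ)..1, (1 + s) ^ 2 *
            density (periodization V) ((1 + s) * r) (ι' (f t + bump N (d / 4) ω t)) := by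
          refine intervalIntegral.integral_mono_on zero_le_one
            (intervalIntegrable_density_comp hU hr ι hg _ _)
            ((intervalIntegrable_density_comp hU (by positivity) ι' hg _ _).const_mul _)
            fun t ht => ?_
          -- The net controls `ι` only on the ball of radius `4`. There `ι'` differs from `ι`, up to
          -- a lattice vector, by at most `s r`, and enlarging `r` to `(1 + s) r` absorbs the
          -- difference.
          have hx : ‖f t + bump N (d / 4) ω t‖ ≤ 4 := by
            linarith [norm_add_le (f t) (bump N (d / 4) ω t), hfb t ht, hu t]
          have := density_le_of_ball_subset (U := periodization V) hr
            (R' := (1 + s) * r) (add_le_of_le_sub_right ((hz _ hx).trans_eq (by ring)))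
          rwa [density_periodization_add, hsr] at this
      _ = (1 + s) ^ 2 * ∫ t in (0 : ℝ)..1,
            density (periodization V) ((1 + s) * r) (ι' (f t + bump N (d / 4) ω t)) :=
          intervalIntegral.integral_const_mul _ _
      _ ≤ (1 + s) ^ 2 * ((1 + s) * ((1 + s) ^ 2 * η) + d) := by
          gcongr
          refine (hbound ι' hι').trans ?_
          have : R / ρ = 1 + s := by rw [hρ]; field_simp
          rw [this]
          linarith
      _ = (1 + s) ^ 5 * η + (1 + s) ^ 2 * d := by ring
      _ ≤ (1 + s) ^ 5 * η + (1 + s) ^ 5 * d := by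
          gcongr
          · linarith
          · norm_num
      _ = (1 + s) ^ 5 * (η + d) := by ring

/-! ### The sequence of scales -/

/-- The scales of the construction. -/
noncomputable def scale (R : ℝ) : ℕ → ℝ
  | 0 => R
  | j + 1 => (1 / 2) ^ j * scale R j / 256

theorem scale_pos {R : ℝ} (hR : 0 < R) (j : ℕ) : 0 < scale R j := by
  induction j with
  | zero => exact hR
  | succ j ih => rw [scale]; positivity

theorem scale_le {R : ℝ} (hR : 0 < R) (hR1 : R ≤ 1) (j : ℕ) : scale R j ≤ (1 / 2) ^ j := by
  induction j with
  | zero => simpa [scale] using hR1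
  | succ j ih =>
    have h1 : ((1 : ℝ) / 2) ^ j ≤ 1 := pow_le_one₀ (by norm_num) (by norm_num)
    have h2 := scale_pos hR j
    rw [scale, pow_succ]
    nlinarith

theorem scale_le_one {R : ℝ} (hR : 0 < R) (hR1 : R ≤ 1) (j : ℕ) : scale R j ≤ 1 :=
  (scale_le hR hR1 j).trans (pow_le_one₀ (by norm_num) (by norm_num))

theorem one_le_log_scale {R : ℝ} (hR : 0 < R) (hR1 : R ≤ 1) (j : ℕ) :
    1 ≤ Real.log (10496 * 4 ^ j / scale R j) := by
  have h0 := scale_pos hR j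
  have h1 := scale_le_one hR hR1 j
  have h2 : (1 : ℝ) ≤ 4 ^ j := one_le_pow₀ (by norm_num)
  rw [Real.le_log_iff_exp_le (by positivity), le_div_iff₀ h0]
  nlinarith [Real.exp_one_lt_d9, Real.exp_pos 1]

/-- One step divides `16 ^ j * scale R j` by `16 * 2 ^ j`, while the logarithm, being at least `1`,
grows by a factor of at most `11 + j`. The smallness condition on `R` therefore propagates to all
scales. -/
theorem scale_mul_log_le {R d : ℝ} (hR : 0 < R) (hR1 : R ≤ 1)
    (h : 208 * R * Real.log (10496 / R) ≤ d ^ 2) (j : ℕ) :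
    208 * (16 ^ j * scale R j) * Real.log (10496 * 4 ^ j / scale R j) ≤ d ^ 2 := by
  induction j with
  | zero => simpa [scale] using h
  | succ j ih =>
    refine le_trans ?_ ih
    have h0 := scale_pos hR j
    set L := Real.log (10496 * 4 ^ j / scale R j) with hL
    have hL1 : 1 ≤ L := one_le_log_scale hR hR1 j
    have e1 : (10496 : ℝ) * 4 ^ (j + 1) / scale R (j + 1) =
        10496 * 4 ^ j / scale R j * 2 ^ (10 + j) := by
      rw [scale, pow_succ, pow_add, one_div, inv_pow]
      field_simp
      norm_num
    have e2 : Real.log (10496 * 4 ^ (j + 1) / scale R (j + 1)) ≤ (11 + j) * L := by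
      rw [e1, Real.log_mul (by positivity) (by positivity), Real.log_pow]
      have hj : (0 : ℝ) ≤ j := Nat.cast_nonneg j
      have : Real.log 2 ≤ 1 := by linarith [Real.log_two_lt_d9]
      push_cast
      nlinarith
    have e3 : (16 : ℝ) ^ (j + 1) * scale R (j + 1) = 16 ^ j * scale R j / (16 * 2 ^ j) := by
      rw [scale, pow_succ, one_div, inv_pow]
      field_simp
      norm_num
    have e4 : (11 + j : ℝ) ≤ 16 * 2 ^ j := by
      have h1 : (j : ℝ) ≤ 2 ^ j := by exact_mod_cast (Nat.lt_two_pow_self (n := j)).le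
      have h2 : (1 : ℝ) ≤ 2 ^ j := one_le_pow₀ (by norm_num)
      linarith
    rw [e3]
    calc _ ≤ 208 * (16 ^ j * scale R j / (16 * 2 ^ j)) * ((11 + j) * L) := by gcongr
      _ ≤ 208 * (16 ^ j * scale R j / (16 * 2 ^ j)) * ((16 * 2 ^ j) * L) := by gcongr
      _ = _ := by field_simp

/-- The hypothesis on `N` in `exists_refinement` for `s = 2⁻ʲ`, error `d 2⁻ʲ` and Lipschitz constant
`2⁻ʲ⁻¹`. In `208 = 13 * 16`, the `13` is `12` plus one for rounding up, and `16` is `8` times the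
`2` from the Lipschitz constant. -/
theorem refinement_condition {R d : ℝ} (hR : 0 < R) (hR1 : R ≤ 1) (hd : 0 < d) (hd1 : d ≤ 1)
    (h : 208 * R * Real.log (10496 / R) ≤ d ^ 2) (j : ℕ) :
    12 / ((1 / 2) ^ j * (d * (1 / 2) ^ j)) *
      Real.log (41 / ((1 / 2) ^ j * scale R (j + 1))) + 1 ≤
      (1 / 2) ^ (j + 1) * (d * (1 / 2) ^ j) / (8 * scale R j) := by
  have h0 := scale_pos hR j
  have hinv := scale_mul_log_le hR hR1 h j
  have hL1 := one_le_log_scale hR hR1 j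
  have e1 : 41 / ((1 / 2) ^ j * scale R (j + 1)) = 10496 * 4 ^ j / scale R j := by
    have : (4 : ℝ) ^ j = 2 ^ j * 2 ^ j := by rw [← mul_pow]; norm_num
    rw [scale, one_div, inv_pow, this]
    field_simp
    norm_num
  rw [e1]
  set L := Real.log (10496 * 4 ^ j / scale R j) with hL
  have e2 : (12 : ℝ) / ((1 / 2) ^ j * (d * (1 / 2) ^ j)) = 12 * (4 ^ j / d) := by
    have : (4 : ℝ) ^ j = 2 ^ j * 2 ^ j := by rw [← mul_pow]; norm_num
    rw [one_div, inv_pow, this]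
    field_simp
  have e3 : ((1 : ℝ) / 2) ^ (j + 1) * (d * (1 / 2) ^ j) / (8 * scale R j) =
      d / (16 * 4 ^ j * scale R j) := by
    have : (4 : ℝ) ^ j = 2 ^ j * 2 ^ j := by rw [← mul_pow]; norm_num
    rw [pow_succ, one_div, inv_pow, this]
    field_simp
    norm_num
  rw [e2, e3]
  have h4 : (1 : ℝ) ≤ 4 ^ j / d := by
    rw [le_div_iff₀ hd]
    have : (1 : ℝ) ≤ 4 ^ j := one_le_pow₀ (by norm_num)
    linarith
  have h5 : (16 : ℝ) ^ j = 4 ^ j * 4 ^ j := by rw [← mul_pow]; norm_num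
  calc 12 * (4 ^ j / d) * L + 1 ≤ 13 * (4 ^ j / d) * L := by nlinarith
    _ = 13 * 4 ^ j * L / d := by ring
    _ ≤ d / (16 * 4 ^ j * scale R j) := by
        rw [div_le_div_iff₀ hd (by positivity)]
        rw [h5] at hinv
        nlinarith

/-! ### Iteration and passage to the limit -/

/-- The properties of the perturbation of the segment reached after `j` steps. -/
structure IsStage (V : Set Plane) (R η d : ℝ) (j : ℕ) (v : ℝ → Plane) : Prop where
  map_zero : v 0 = 0
  norm_sub_le : ∀ t t', ‖v t - v t'‖ ≤ (1 - (1 / 2) ^ j) * |t - t'|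
  integral_le : ∀ ι : Plane ≃ᵢ Plane, ∫ t in (0 : ℝ)..1,
    density (periodization V) (scale R j) (ι ((2 * t) • coordVec 0 + v t)) ≤
      Real.exp (5 * (2 - 2 * (1 / 2) ^ j)) * (η + d * (2 - 2 * (1 / 2) ^ j))

theorem IsStage.norm_sub_le_abs {V : Set Plane} {R η d : ℝ} {j : ℕ} {v : ℝ → Plane}
    (h : IsStage V R η d j v) (t t' : ℝ) : ‖v t - v t'‖ ≤ |t - t'| := by
  refine (h.norm_sub_le t t').trans (mul_le_of_le_one_left (abs_nonneg _) ?_)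
  have : (0 : ℝ) < (1 / 2) ^ j := by positivity
  linarith

theorem continuous_of_norm_sub_le {v : ℝ → Plane} (h : ∀ t t', ‖v t - v t'‖ ≤ |t - t'|) :
    Continuous v :=
  (LipschitzWith.of_dist_le_mul (K := 1) fun t t' => by
    rw [dist_eq_norm, Real.dist_eq, NNReal.coe_one, one_mul]; exact h t t').continuous

/-- The Lipschitz constants `2⁻ⁱ⁻¹` add up to `1 - 2⁻ʲ` and the errors `d 2⁻ⁱ` to `d (2 - 2 · 2⁻ʲ)`;
the losses `(1 + 2⁻ⁱ)⁵` are bounded by exponentials, so their product is governed by the same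
geometric sum. -/
theorem IsStage.exists_next {V : Set Plane} (hV : IsOpen V) {R η d : ℝ} (hR : 0 < R) (hR1 : R ≤ 1)
    (hη : 0 ≤ η) (hd : 0 < d) (hd1 : d ≤ 1) (hRd : 208 * R * Real.log (10496 / R) ≤ d ^ 2) {j : ℕ}
    {v : ℝ → Plane} (h : IsStage V R η d j v) :
    ∃ v', IsStage V R η d (j + 1) v' ∧ ∀ t, ‖v' t - v t‖ ≤ (1 / 2) ^ j := by
  have hv := continuous_of_norm_sub_le h.norm_sub_le_abs
  have hs0 : (0 : ℝ) < (1 / 2) ^ j := by positivity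
  have hs1 : ((1 : ℝ) / 2) ^ j ≤ 1 := pow_le_one₀ (by norm_num) (by norm_num)
  have hσ : 0 ≤ 2 - 2 * ((1 : ℝ) / 2) ^ j := by linarith
  have hRj := scale_pos hR j
  have hf : Continuous fun t : ℝ => (2 * t) • coordVec 0 + v t := by fun_prop
  have hfb : ∀ t ∈ Set.Icc (0 : ℝ) 1, ‖(2 * t) • coordVec 0 + v t‖ ≤ 3 := fun t ht => by
    have h1 : ‖(2 * t) • coordVec 0‖ = 2 * t := by
      rw [norm_smul, norm_coordVec, mul_one, Real.norm_of_nonneg (by linarith [ht.1])]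
    have h2 := h.norm_sub_le_abs t 0
    rw [h.map_zero, sub_zero, sub_zero, abs_of_nonneg ht.1] at h2
    linarith [norm_add_le ((2 * t) • coordVec 0) (v t), ht.2]
  obtain ⟨u, hu0, hunorm, hulip, huint⟩ := exists_refinement hV hf hfb hRj (scale_le_one hR hR1 j)
    (scale_pos hR (j + 1)) hs0 hs1 (d := d * (1 / 2) ^ j) (by positivity) (by nlinarith)
    (by rw [scale]; nlinarith) (refinement_condition hR hR1 hd hd1 hRd j) h.integral_le
  refine ⟨fun t => v t + u t, ⟨by simp [hu0, h.map_zero], fun t t' => ?_, fun ι => ?_⟩,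
    fun t => ?_⟩
  · have h1 := norm_add_le (v t - v t') (u t - u t')
    have h2 := h.norm_sub_le t t'
    have h3 := hulip t t'
    rw [add_sub_add_comm]
    refine h1.trans ((add_le_add h2 h3).trans_eq ?_)
    rw [pow_succ]
    ring
  · have h1 := huint ι
    simp only [← add_assoc]
    refine h1.trans ?_
    set s : ℝ := (1 / 2) ^ j with hs
    have e1 : (1 + s) ^ 5 ≤ Real.exp (5 * s) := by
      have h2 : 1 + s ≤ Real.exp s := by linarith [Real.add_one_le_exp s]
      calc (1 + s) ^ 5 ≤ (Real.exp s) ^ 5 := by gcongr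
        _ = Real.exp (5 * s) := by rw [← Real.exp_nat_mul]; norm_num
    have e2 : 2 - 2 * ((1 : ℝ) / 2) ^ (j + 1) = (2 - 2 * s) + s := by rw [pow_succ, ← hs]; ring
    rw [e2, mul_add 5, Real.exp_add]
    set Q := Real.exp (5 * (2 - 2 * s)) with hQ
    have hQ1 : 1 ≤ Q := Real.one_le_exp (by positivity)
    have e3 : Q * (η + d * (2 - 2 * s)) + d * s ≤ Q * (η + d * (2 - 2 * s + s)) := by
      have : d * s ≤ Q * (d * s) := le_mul_of_one_le_left (by positivity) hQ1
      linarith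
    calc (1 + s) ^ 5 * (Q * (η + d * (2 - 2 * s)) + d * s)
        ≤ Real.exp (5 * s) * (Q * (η + d * (2 - 2 * s + s))) := by gcongr
      _ = _ := by ring
  · rw [add_sub_cancel_left]
    exact (hunorm t).trans (scale_le hR hR1 j)

/-- If an open set is small, there is a Lipschitz graph over the segment such that all congruent
copies of it spend little time in that set. -/
theorem exists_perturbed_segment {V : Set Plane} (hV : IsOpen V) {R M d : ℝ} (hR : 0 < R)
    (hR1 : R ≤ 1) (hM0 : 0 ≤ M) (hM : 49 * volume V ≤ ENNReal.ofReal M) (hd : 0 < d) (hd1 : d ≤ 1)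
    (hRd : 208 * R * Real.log (10496 / R) ≤ d ^ 2) :
    ∃ w : ℝ → Plane, (∀ t t', ‖w t - w t'‖ ≤ |t - t'|) ∧ ∀ ι : Plane ≃ᵢ Plane,
      volume {t ∈ Set.Icc (0 : ℝ) 1 | ι ((2 * t) • coordVec 0 + w t) ∈ V} ≤
        ENNReal.ofReal (Real.exp 10 * (M / R + d * 2)) := by
  have hUo := isOpen_periodization hV
  have hU : MeasurableSet (periodization V) := hUo.measurableSet
  have hη : 0 ≤ M / R := by positivity
  have hstage : IsStage V R (M / R) d 0 (fun _ => 0) := by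
    refine ⟨rfl, fun t t' => by simp, fun ι => ?_⟩
    have := integral_density_segment_le hU hR hR1 hM0
      (fun a => (volume_periodization_inter_ball_le hV.measurableSet a).trans hM) ι
      (norm_coordVec 0)
    simpa [scale] using this
  have hnext : ∀ (j : ℕ) (v : {v // IsStage V R (M / R) d j v}),
      ∃ v' : {v // IsStage V R (M / R) d (j + 1) v}, ∀ t, ‖v'.1 t - v.1 t‖ ≤ (1 / 2) ^ j :=
    fun j v => by
      obtain ⟨v', h1, h2⟩ := v.2.exists_next hV hR hR1 hη hd hd1 hRd
      exact ⟨⟨v', h1⟩, h2⟩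
  choose F hF using hnext
  set v : ∀ j : ℕ, {v // IsStage V R (M / R) d j v} := fun j => Nat.rec ⟨_, hstage⟩ F j with hv
  have hvF : ∀ j t, ‖(v (j + 1)).1 t - (v j).1 t‖ ≤ (1 / 2) ^ j := fun j => hF j (v j)
  have hlim : ∀ t, ∃ y, Tendsto (fun j => (v j).1 t) atTop (𝓝 y) := fun t => by
    refine cauchySeq_tendsto_of_complete
      (cauchySeq_of_le_geometric (1 / 2) 1 (by norm_num) fun j => ?_)
    rw [dist_comm, dist_eq_norm, one_mul]
    exact hvF j t
  choose w hw using hlim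
  have hwlip : ∀ t t', ‖w t - w t'‖ ≤ |t - t'| := fun t t' =>
    le_of_tendsto ((hw t).sub (hw t')).norm
      (Eventually.of_forall fun j => (v j).2.norm_sub_le_abs t t')
  refine ⟨w, hwlip, fun ι => ?_⟩
  have hwc := continuous_of_norm_sub_le hwlip
  have hvc : ∀ j, Continuous (v j).1 := fun j => continuous_of_norm_sub_le (v j).2.norm_sub_le_abs
  set h : ℕ → ℝ → ℝ := fun j t =>
    density (periodization V) (scale R j) (ι ((2 * t) • coordVec 0 + (v j).1 t)) with hh
  have hgc : ∀ j, Continuous fun t : ℝ => (2 * t) • coordVec 0 + (v j).1 t := fun j => by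
    have := hvc j; fun_prop
  have hhm : ∀ j, Measurable (h j) := fun j => measurable_density_comp hU _ ι (hgc j)
  have hscale : Tendsto (scale R) atTop (𝓝 0) :=
    squeeze_zero (fun j => (scale_pos hR j).le) (scale_le hR hR1)
      (tendsto_pow_atTop_nhds_zero_of_lt_one (by norm_num) (by norm_num))
  set A : Set ℝ := {t | ι ((2 * t) • coordVec 0 + w t) ∈ V} with hA
  have hAm : MeasurableSet A := by
    refine (hV.preimage (ι.continuous.comp ?_)).measurableSet
    fun_prop
  -- If the limit point lies in the open periodization, a whole disc about it does, and the discs of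
  -- radius `scale R j` about the approximating points end up inside it: the densities are
  -- eventually `1`. Fatou's lemma then transfers the uniform bound on their integrals to `A`.
  have hpt : ∀ t, A.indicator 1 t ≤ liminf (fun j => ENNReal.ofReal (h j t)) atTop := fun t => by
    by_cases ht : t ∈ A
    · rw [Set.indicator_of_mem ht]
      refine le_liminf_of_le (by isBoundedDefault) ?_
      have hy : ι ((2 * t) • coordVec 0 + w t) ∈ periodization V := subset_periodization V ht
      obtain ⟨ε, hε, hball⟩ := Metric.isOpen_iff.1 hUo _ hy
      have h1 : Tendsto (fun j => ι ((2 * t) • coordVec 0 + (v j).1 t)) atTop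
          (𝓝 (ι ((2 * t) • coordVec 0 + w t))) :=
        (ι.continuous.tendsto _).comp ((hw t).const_add _)
      filter_upwards [Metric.tendsto_nhds.1 h1 (ε / 2) (half_pos hε),
        hscale.eventually_lt_const (half_pos hε)] with j hj1 hj2
      have : h j t = 1 := density_eq_one_of_ball_subset (scale_pos hR j)
        ((ball_subset_ball' (by linarith)).trans hball)
      rw [this]
      simp
    · rw [Set.indicator_of_notMem ht]
      exact bot_le
  have hint : ∀ j, ∫⁻ t in Set.Icc (0 : ℝ) 1, ENNReal.ofReal (h j t) ≤
      ENNReal.ofReal (Real.exp 10 * (M / R + d * 2)) := fun j => by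
    have hi := intervalIntegrable_density_comp hU (scale_pos hR j) ι (hgc j) 0 1
    rw [intervalIntegrable_iff, Set.uIoc_of_le zero_le_one, ← integrableOn_Icc_iff_integrableOn_Ioc]
      at hi
    rw [← ofReal_integral_eq_lintegral_ofReal hi
      (Eventually.of_forall fun t => density_nonneg _ _ _)]
    refine ENNReal.ofReal_le_ofReal ?_
    have h1 := (v j).2.integral_le ι
    rw [intervalIntegral.integral_of_le zero_le_one, ← integral_Icc_eq_integral_Ioc] at h1
    refine h1.trans ?_
    have h2 : (0 : ℝ) < (1 / 2) ^ j := by positivity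
    have h3 : ((1 : ℝ) / 2) ^ j ≤ 1 := pow_le_one₀ (by norm_num) (by norm_num)
    have h4 : 0 ≤ d * (2 - 2 * (1 / 2) ^ j) := mul_nonneg hd.le (by linarith)
    gcongr
    · linarith
    · linarith
  calc volume {t ∈ Set.Icc (0 : ℝ) 1 | ι ((2 * t) • coordVec 0 + w t) ∈ V}
      = ∫⁻ t in Set.Icc (0 : ℝ) 1, A.indicator 1 t := by
        rw [lintegral_indicator_one hAm, Measure.restrict_apply hAm, Set.inter_comm]
        rfl
    _ ≤ ∫⁻ t in Set.Icc (0 : ℝ) 1, liminf (fun j => ENNReal.ofReal (h j t)) atTop :=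
        lintegral_mono hpt
    _ ≤ liminf (fun j => ∫⁻ t in Set.Icc (0 : ℝ) 1, ENNReal.ofReal (h j t)) atTop :=
        lintegral_liminf_le fun j => (hhm j).ennreal_ofReal
    _ ≤ liminf (fun _ : ℕ => ENNReal.ofReal (Real.exp 10 * (M / R + d * 2))) atTop :=
        liminf_le_liminf (Eventually.of_forall hint)
    _ = _ := liminf_const _

/-! ### Extracting a curve of length one -/

/-- The segment has speed `2` and the perturbation is `1`-Lipschitz, so the curve separates
parameters at rate at least `1`. This yields injectivity and length at least one. -/
theorem antilipschitzWith_perturbed_segment {w : ℝ → Plane}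
    (hw : ∀ t t', ‖w t - w t'‖ ≤ |t - t'|) :
    AntilipschitzWith 1 fun t : ℝ => (2 * t) • coordVec 0 + w t := by
  refine AntilipschitzWith.of_le_mul_dist fun t t' => ?_
  rw [NNReal.coe_one, one_mul, Real.dist_eq, dist_eq_norm]
  have h1 : ‖(2 * t) • coordVec 0 - (2 * t') • coordVec 0‖ = 2 * |t - t'| := by
    rw [← sub_smul, norm_smul, norm_coordVec, ← mul_sub]; simp
  have h2 := norm_sub_le_norm_add ((2 * t) • coordVec 0 - (2 * t') • coordVec 0) (w t - w t')
  rw [add_sub_add_comm]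
  linarith [hw t t']

theorem lipschitzWith_perturbed_segment {w : ℝ → Plane}
    (hw : ∀ t t', ‖w t - w t'‖ ≤ |t - t'|) :
    LipschitzWith 3 fun t : ℝ => (2 * t) • coordVec 0 + w t := by
  refine LipschitzWith.of_dist_le_mul fun t t' => ?_
  have h1 : ‖(2 * t) • coordVec 0 - (2 * t') • coordVec 0‖ = 2 * |t - t'| := by
    rw [← sub_smul, norm_smul, norm_coordVec, ← mul_sub]; simp
  have h2 := norm_add_le ((2 * t) • coordVec 0 - (2 * t') • coordVec 0) (w t - w t')
  rw [dist_eq_norm, Real.dist_eq, add_sub_add_comm]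
  push_cast
  linarith [hw t t']

theorem LipschitzWith.hausdorffMeasure_one_image_le {K : NNReal} {Γ : ℝ → Plane}
    (hΓ : LipschitzWith K Γ) (s : Set ℝ) : μH[1] (Γ '' s) ≤ K * volume s := by
  have := hΓ.hausdorffMeasure_image_le zero_le_one s
  rwa [hausdorffMeasure_real, ENNReal.rpow_one] at this

/-- A bi-Lipschitz curve whose length is at least one has an initial piece of length one. -/
theorem exists_isUnitLengthCurve {K : NNReal} {Γ : ℝ → Plane} (hΓ : LipschitzWith K Γ)
    (hΓ' : AntilipschitzWith 1 Γ) :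
    ∃ T ∈ Set.Icc (0 : ℝ) 1, IsUnitLengthCurve (Γ '' Set.Icc 0 T) := by
  have hfin : ∀ a b, μH[1] (Γ '' Set.Icc a b) ≠ ⊤ := fun a b =>
    ((hΓ.hausdorffMeasure_one_image_le _).trans_lt
      (ENNReal.mul_lt_top ENNReal.coe_lt_top (by simp))).ne
  set h : ℝ → ℝ := fun T => (μH[1] (Γ '' Set.Icc 0 T)).toReal with hh
  have hmono : ∀ S T, S ≤ T → h S ≤ h T := fun S T hST =>
    ENNReal.toReal_mono (hfin _ _) (measure_mono (Set.image_mono (Set.Icc_subset_Icc_right hST)))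
  have hstep : ∀ S T, S ≤ T → h T ≤ h S + K * (T - S) := fun S T hST => by
    have h1 : Γ '' Set.Icc 0 T ⊆ Γ '' Set.Icc 0 S ∪ Γ '' Set.Icc S T := by
      rw [← Set.image_union]
      refine Set.image_mono fun t ht => ?_
      rcases le_total t S with h | h
      · exact Or.inl ⟨ht.1, h⟩
      · exact Or.inr ⟨h, ht.2⟩
    have h2 : μH[1] (Γ '' Set.Icc 0 T) ≤
        μH[1] (Γ '' Set.Icc 0 S) + K * ENNReal.ofReal (T - S) := by
      refine (measure_mono h1).trans ((measure_union_le _ _).trans ?_)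
      gcongr
      refine (hΓ.hausdorffMeasure_one_image_le _).trans_eq ?_
      rw [Real.volume_Icc]
    have hne : (K : ENNReal) * ENNReal.ofReal (T - S) ≠ ⊤ :=
      ENNReal.mul_ne_top ENNReal.coe_ne_top ENNReal.ofReal_ne_top
    have h3 := ENNReal.toReal_mono (ENNReal.add_ne_top.2 ⟨hfin 0 S, hne⟩) h2
    rw [ENNReal.toReal_add (hfin 0 S) hne, ENNReal.toReal_mul,
      ENNReal.toReal_ofReal (by linarith)] at h3
    exact h3
  have hcont : Continuous h := by
    refine (LipschitzWith.of_dist_le_mul (K := K) fun S T => ?_).continuous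
    rw [Real.dist_eq, Real.dist_eq]
    rcases le_total S T with hST | hST
    · rw [abs_sub_comm, abs_of_nonneg (sub_nonneg.2 (hmono S T hST)), abs_sub_comm,
        abs_of_nonneg (sub_nonneg.2 hST)]
      linarith [hstep S T hST]
    · rw [abs_of_nonneg (sub_nonneg.2 (hmono T S hST)), abs_of_nonneg (sub_nonneg.2 hST)]
      linarith [hstep T S hST]
  have h0 : h 0 = 0 := by
    have : μH[1] (Γ '' Set.Icc 0 0) = 0 :=
      le_antisymm ((hΓ.hausdorffMeasure_one_image_le _).trans (by simp)) bot_le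
    simp only [hh, this, ENNReal.toReal_zero]
  have h1 : 1 ≤ h 1 := by
    have := hΓ'.le_hausdorffMeasure_image zero_le_one (Set.Icc (0 : ℝ) 1)
    rw [hausdorffMeasure_real, Real.volume_Icc, sub_zero, ENNReal.ofReal_one, ENNReal.coe_one,
      ENNReal.one_rpow, one_mul] at this
    have := ENNReal.toReal_mono (hfin 0 1) this
    rwa [ENNReal.toReal_one] at this
  -- The length of the initial piece depends continuously on its end, vanishes at `0` and is at
  -- least `1` at `1`.
  obtain ⟨T, hT, hT1⟩ := intermediate_value_Icc (zero_le_one (α := ℝ)) hcont.continuousOn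
    (show (1 : ℝ) ∈ Set.Icc (h 0) (h 1) from ⟨by rw [h0]; exact zero_le_one, h1⟩)
  have hT0 : 0 < T := by
    refine lt_of_le_of_ne hT.1 fun h => ?_
    rw [← h, h0] at hT1
    exact zero_ne_one hT1
  refine ⟨T, hT, ⟨fun x => Γ (T * x), ?_, ?_, ?_⟩, ?_⟩
  · exact (hΓ.continuous.comp (continuous_const.mul continuous_id)).continuousOn
  · intro x _ y _ hxy
    exact mul_left_cancel₀ hT0.ne' (hΓ'.injective hxy)
  · have : (fun x => Γ (T * x)) = Γ ∘ fun x => T * x := rfl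
    rw [this, Set.image_comp, Set.image_mul_left_Icc hT0.le zero_le_one, mul_zero, mul_one]
  · rwa [← ENNReal.toReal_eq_one_iff]

/-! ### Choice of constants and conclusion -/

/-- A power of the scale absorbs the logarithmic loss, as soon as `p > 3`. -/
theorem exists_scale_constant {p : ℝ} (hp : 3 < p) {c : ℝ} (hc : 0 < c) :
    ∃ K : ℝ, 0 < K ∧ K ≤ 1 ∧ ∀ δ : ℝ, 0 < δ →
      208 * (K * δ ^ (p - 1)) * Real.log (10496 / (K * δ ^ (p - 1))) ≤ (c * δ) ^ 2 := by
  -- The exponent with `(p - 1) (1 - a) = 2`. Since `log x ≤ x ^ a / a`, the left side is at most a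
  -- multiple of `R ^ (1 - a) = K ^ (1 - a) * δ ^ 2`, and a small `K` does the rest; `a > 0` is
  -- exactly `p > 3`.
  set a := (p - 3) / (p - 1) with ha
  have hp1 : 0 < p - 1 := by linarith
  have ha0 : 0 < a := div_pos (by linarith) hp1
  have hb : 1 - a = 2 / (p - 1) := by rw [ha]; field_simp; ring
  have hb0 : 0 < 1 - a := by rw [hb]; positivity
  set B : ℝ := 208 * 10496 ^ a / a with hB
  have hB0 : 0 < B := by positivity
  refine ⟨min 1 ((c ^ 2 / B) ^ (1 / (1 - a))), lt_min one_pos (by positivity), min_le_left _ _,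
    fun δ hδ => ?_⟩
  set K := min 1 ((c ^ 2 / B) ^ (1 / (1 - a))) with hK
  have hK0 : 0 < K := lt_min one_pos (by positivity)
  have hKpow : K ^ (1 - a) ≤ c ^ 2 / B := by
    calc K ^ (1 - a) ≤ ((c ^ 2 / B) ^ (1 / (1 - a))) ^ (1 - a) :=
          Real.rpow_le_rpow hK0.le (min_le_right _ _) hb0.le
      _ = c ^ 2 / B := by
          rw [← Real.rpow_mul (by positivity), one_div, inv_mul_cancel₀ hb0.ne', Real.rpow_one]
  set R := K * δ ^ (p - 1) with hR
  have hR0 : 0 < R := by positivity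
  have hRpow : R ^ (1 - a) = K ^ (1 - a) * δ ^ 2 := by
    rw [hR, Real.mul_rpow hK0.le (by positivity), ← Real.rpow_mul hδ.le, hb,
      mul_div_cancel₀ _ hp1.ne', Real.rpow_two]
  calc 208 * R * Real.log (10496 / R) ≤ 208 * R * ((10496 / R) ^ a / a) := by
        gcongr
        exact Real.log_le_rpow_div (by positivity) ha0
    _ = B * R ^ (1 - a) := by
        rw [Real.div_rpow (by norm_num) hR0.le, Real.rpow_sub hR0, Real.rpow_one, hB]
        ring
    _ ≤ B * (c ^ 2 / B * δ ^ 2) := by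
        rw [hRpow]; gcongr
    _ = (c * δ) ^ 2 := by field_simp

theorem corollary2 (p : ℝ) (hp : 3 < p) :
    ∃ c : ℝ, 0 < c ∧
      ∀ δ : ℝ, 0 < δ → δ ≤ 1 →
        ∀ (E : Set Plane → Set Plane) (ι : Set Plane → (Plane ≃ᵢ Plane)),
          (∀ γ : Set Plane, IsUnitLengthCurve γ →
            E γ ⊆ γ ∧ IsH1Measurable (E γ) ∧ ENNReal.ofReal δ ≤ μH[1] (E γ)) →
          ENNReal.ofReal (c * δ ^ p) ≤
            (volume : Measure Plane) (⋃ γ ∈ {γ : Set Plane | IsUnitLengthCurve γ}, ι γ '' E γ) := by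
  -- With `R = K δ ^ (p - 1)`, `M = c K δ ^ p` and `d = c δ`, the bound `exp 10 * (M / R + 2 d)`
  -- equals `3 δ / 10`. The Lipschitz constant `3` turns it into length `9 δ / 10 < δ`.
  set c : ℝ := (10 * Real.exp 10)⁻¹ with hc
  have hexp : 1 ≤ Real.exp 10 := Real.one_le_exp (by norm_num)
  have hc0 : 0 < c := by positivity
  have hc1 : c ≤ 1 := inv_le_one_of_one_le₀ (by linarith)
  obtain ⟨K, hK0, hK1, hK⟩ := exists_scale_constant hp hc0
  refine ⟨c * K / 49, by positivity, fun δ hδ hδ1 E ι hE => ?_⟩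
  by_contra! hlt
  obtain ⟨V, hEV, hVo, hVlt⟩ := Set.exists_isOpen_lt_of_lt _ _ hlt
  have hRpos : 0 < K * δ ^ (p - 1) := by positivity
  have hR1 : K * δ ^ (p - 1) ≤ 1 :=
    mul_le_one₀ hK1 (by positivity) (Real.rpow_le_one hδ.le hδ1 (by linarith))
  have hM : 49 * volume V ≤ ENNReal.ofReal (49 * (c * K / 49 * δ ^ p)) := by
    rw [ENNReal.ofReal_mul (by norm_num)]
    gcongr
    simp
  -- The curve depends only on `V`, and the estimate holds for every isometry, in particular for the
  -- one assigned to the curve found afterwards.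
  obtain ⟨w, hw, hvol⟩ := exists_perturbed_segment hVo hRpos hR1 (by positivity) hM
    (d := c * δ) (by positivity) (mul_le_one₀ hc1 hδ.le hδ1) (hK δ hδ)
  set Γ : ℝ → Plane := fun t => (2 * t) • coordVec 0 + w t with hΓ
  have hΓl := lipschitzWith_perturbed_segment hw
  obtain ⟨T, hT, hγ⟩ := exists_isUnitLengthCurve hΓl (antilipschitzWith_perturbed_segment hw)
  set γ := Γ '' Set.Icc 0 T with hγdef
  obtain ⟨hEγ, -, hEδ⟩ := hE γ hγ
  have hsub : E γ ⊆ Γ '' {t ∈ Set.Icc (0 : ℝ) 1 | ι γ (Γ t) ∈ V} := by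
    intro x hx
    obtain ⟨t, ht, rfl⟩ := hEγ hx
    exact ⟨t, ⟨⟨ht.1, ht.2.trans hT.2⟩, hEV (Set.mem_biUnion hγ ⟨_, hx, rfl⟩)⟩, rfl⟩
  have hle : ENNReal.ofReal δ ≤ ENNReal.ofReal (9 / 10 * δ) := by
    calc ENNReal.ofReal δ ≤ μH[1] (E γ) := hEδ
      _ ≤ (3 : NNReal) * volume {t ∈ Set.Icc (0 : ℝ) 1 | ι γ (Γ t) ∈ V} :=
        (measure_mono hsub).trans (hΓl.hausdorffMeasure_one_image_le _)
      _ ≤ (3 : NNReal) * ENNReal.ofReal (Real.exp 10 *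
            (49 * (c * K / 49 * δ ^ p) / (K * δ ^ (p - 1)) + c * δ * 2)) := by
          gcongr
          exact hvol (ι γ)
      _ = ENNReal.ofReal (9 / 10 * δ) := by
          rw [← ENNReal.ofReal_coe_nnreal, ← ENNReal.ofReal_mul (by positivity)]
          congr 1
          have h1 : δ ^ p = δ ^ (p - 1) * δ := by
            rw [← Real.rpow_add_one hδ.ne', sub_add_cancel]
          have h2 : (0 : ℝ) < δ ^ (p - 1) := by positivity
          rw [h1, hc]
          push_cast
          field_simp
          norm_num
  rw [ENNReal.ofReal_le_ofReal_iff (by positivity)] at hle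
  linarith
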